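/- Let $\mathbb F_q$ be a finite field, let $X$ be a smooth projective, geometrically integral curve over the rational function field $\mathbb F_q(z)$, with function field $\Sigma_X$ and genus $g=\dim_{\mathbb F_q(z)}H^1(X,\mathcal O_X)$. Let $p_1,\dots,p_n$ be $n\ge 0$ distinct $\mathbb F_q(z)$-rational points of $X$, let $D=p_1+\dots+p_n$, and let $G$ be a divisor on $X$ of degree $r$ whose support is disjoint from that of $D$. Put $$L(G)=\Gamma(X,\mathcal O_X(G))=\{0\}\cup\{s\in\Sigma_X\setminus\{0\} : (s)+G\ge 0\},$$ where $(s)$ is the divisor of $s$. Every $s\in L(G)$ is regular at each $p_i$ and has a value $s(p_i)\in\mathcal O_{X,p_i}/\mathfrak m_{p_i}\simeq\mathbb F_q(z)$. The convolutional Goppa code $\mathcal C(D,G)\subseteq\mathbb F_q(z)^n$ is defined as the image of the $\mathbb F_q(z)$-linear evaluation map $$\alpha\colon L(G)\to\mathbb F_q(z)^n,\qquad \alpha(s)=(s(p_1),\dots,s(p_n)).$$ If $2g-2<r<n$, then $\alpha$ is injective and $$\dim_{\mathbb F_q(z)}\mathcal C(D,G)=r+1-g.$$ -/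

import Mathlib

universe u

noncomputable section

namespace ConvolutionalGoppa

open AlgebraicGeometry CategoryTheory

/-- The local rings of an étale algebra over a Dedekind domain, at primes lying over nonzero primes,
are discrete valuation rings. -/
theorem isDVR_of_etale {B A : Type*} [CommRing B] [IsDedekindDomain B]
    [CommRing A] [Algebra B A] [Algebra.Etale B A] (q : Ideal A) [q.IsPrime]
    [IsDomain (Localization.AtPrime q)] (hq : q.under B ≠ ⊥) :
    IsDiscreteValuationRing (Localization.AtPrime q) := by
  let p := q.under B
  let := Localization.AtPrime.algebraOfLiesOver p q
  have hp := IsLocalization.AtPrime.isDiscreteValuationRing_of_dedekind_domain B hq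
    (Localization.AtPrime p)
  have : IsLocalHom (algebraMap (Localization.AtPrime p) (Localization.AtPrime q)) := by
    rw [RingHom.algebraMap_toAlgebra]
    exact Localization.isLocalHom_localRingHom p q (algebraMap B A) Ideal.LiesOver.over
  have : Module.FaithfullyFlat (Localization.AtPrime p) (Localization.AtPrime q) :=
    Module.FaithfullyFlat.of_flat_of_isLocalHom
  have : IsNoetherianRing A := Algebra.FiniteType.isNoetherianRing B A
  have : IsNoetherianRing (Localization.AtPrime q) :=
    IsLocalization.isNoetherianRing q.primeCompl _ inferInstance
  have : Algebra.EssFiniteType B (Localization.AtPrime q) := .comp B A _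
  have : Algebra.EssFiniteType (Localization.AtPrime p) (Localization.AtPrime q) :=
    .of_comp B _ _
  have : Algebra.FormallyUnramified B (Localization.AtPrime q) :=
    have : Algebra.FormallyUnramified A (Localization.AtPrime q) :=
      .of_isLocalization q.primeCompl
    .comp B A _
  have : Algebra.FormallyUnramified (Localization.AtPrime p) (Localization.AtPrime q) :=
    .of_restrictScalars B _ _
  have hm := Algebra.FormallyUnramified.map_maximalIdeal (R := Localization.AtPrime p)
    (S := Localization.AtPrime q)
  have hinj : Function.Injective
      (algebraMap (Localization.AtPrime p) (Localization.AtPrime q)) :=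
    FaithfulSMul.algebraMap_injective _ _
  have hf : ¬ IsField (Localization.AtPrime q) := by
    rw [IsLocalRing.isField_iff_maximalIdeal_eq, ← hm, Ideal.map_eq_bot_iff_of_injective hinj]
    exact IsDiscreteValuationRing.not_a_field _
  refine ((IsDiscreteValuationRing.TFAE _ hf).out 4 0).mp ?_
  rw [← hm]
  have : (IsLocalRing.maximalIdeal (Localization.AtPrime p)).IsPrincipal := inferInstance
  infer_instance

/-- The local ring at a maximal ideal of a smooth algebra of relative dimension one over a field is a
discrete valuation ring. -/
theorem isDVR_of_smooth_dim_one {k A O : Type u} [CommRing k] (hk : IsField k)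
    [CommRing A] [Algebra k A] [Algebra.IsStandardSmoothOfRelativeDimension 1 k A]
    (q : Ideal A) [hq : q.IsMaximal] [CommRing O] [IsDomain O] [Algebra A O]
    [IsLocalization.AtPrime O q] : IsDiscreteValuationRing O := by
  let := hk.toField
  obtain ⟨g, hg⟩ := Algebra.IsStandardSmoothOfRelativeDimension.exists_etale_mvPolynomial 1 k A
  let h : Polynomial k →ₐ[k] A := g.comp (MvPolynomial.uniqueAlgEquiv k (Fin 1)).symm.toAlgHom
  have hh : h.toRingHom.Etale := by
    have hs := RingHom.Etale.respectsIso.2 (g : MvPolynomial (Fin 1) k →+* A)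
      ((MvPolynomial.uniqueAlgEquiv k (Fin 1)).symm : Polynomial k ≃+* MvPolynomial (Fin 1) k) hg
    exact hs
  algebraize [h.toRingHom]
  have : IsScalarTower k (Polynomial k) A := .of_algebraMap_eq' h.comp_algebraMap.symm
  let e := IsLocalization.algEquiv q.primeCompl (Localization.AtPrime q) O
  have : IsDomain (Localization.AtPrime q) := e.toMulEquiv.isDomain
  have hb : q.under (Polynomial k) ≠ ⊥ := by
    intro hbot
    let := Ideal.Quotient.field q
    have : Algebra.FiniteType k A := .trans (S := Polynomial k) inferInstance inferInstance
    have : Module.Finite k (A ⧸ q) := finite_of_finite_type_of_isJacobsonRing k (A ⧸ q)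
    have hi : IsIntegral k (algebraMap (Polynomial k) (A ⧸ q) Polynomial.X) :=
      Algebra.IsIntegral.isIntegral _
    have hinj : Function.Injective (algebraMap (Polynomial k) (A ⧸ q)) := by
      rw [injective_iff_map_eq_zero]
      intro a ha
      rw [IsScalarTower.algebraMap_apply (Polynomial k) A (A ⧸ q), Ideal.Quotient.algebraMap_eq,
        Ideal.Quotient.eq_zero_iff_mem] at ha
      have : a ∈ q.under (Polynomial k) := ha
      rwa [hbot] at this
    rw [isIntegral_algebraMap_iff hinj] at hi
    exact Polynomial.transcendental_X k hi.isAlgebraic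
  have := isDVR_of_etale (B := Polynomial k) q hb
  exact IsDiscreteValuationRing.RingEquivClass.isDiscreteValuationRing e

/-- A smooth projective (geometrically integral) curve over a field `k`: a scheme, proper, smooth of
relative dimension one and geometrically integral over `Spec k`. (A proper curve over a field is
automatically projective.) -/
structure SmoothProjectiveCurve (k : Type u) [Field k] where
  /-- the underlying scheme -/
  X : Scheme.{u}
  /-- the structure morphism -/
  hom : X ⟶ Spec (CommRingCat.of k)
  [proper : IsProper hom]
  [smooth : SmoothOfRelativeDimension 1 hom]
  [geometricallyIntegral : GeometricallyIntegral hom]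

namespace SmoothProjectiveCurve

variable {k : Type u} [Field k] (C : SmoothProjectiveCurve k)

instance : IsProper C.hom := C.proper

instance : SmoothOfRelativeDimension 1 C.hom := C.smooth

instance : GeometricallyIntegral C.hom := C.geometricallyIntegral

instance : IsIntegral C.X :=
  GeometricallyIntegral.isIntegral_of_subsingleton C.hom

/-- The local ring `O_x` of the curve at a point `x`. -/
abbrev LocalRing (x : C.X) : Type u := C.X.presheaf.stalk x

/-- The field of rational functions of the curve: the local ring at the generic point. -/
abbrev FunctionField : Type u := C.X.functionField

/-- The structure map `k → O_x`, the composite `k → Γ(X, O_X) → O_x`. -/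
def toLocalRing (x : C.X) : k →+* C.LocalRing x :=
  ((Scheme.ΓSpecIso (CommRingCat.of k)).inv ≫ C.hom.appTop ≫
    C.X.presheaf.germ ⊤ x (TopologicalSpace.Opens.mem_top x)).hom

instance (x : C.X) : Algebra k (C.LocalRing x) := (C.toLocalRing x).toAlgebra

instance (x : C.X) : IsScalarTower k (C.LocalRing x) C.FunctionField := by
  apply IsScalarTower.of_algebraMap_eq'
  have h := C.X.presheaf.germ_stalkSpecializes (U := ⊤) (TopologicalSpace.Opens.mem_top x)
    ((genericPoint_spec C.X).specializes trivial)
  exact congrArg (fun f => ((Scheme.ΓSpecIso (CommRingCat.of k)).inv ≫ C.hom.appTop ≫ f).hom) h.symm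

/-- The closed points of the curve. -/
def ClosedPoint : Type u := {x : C.X // IsClosed ({x} : Set C.X)}

variable {C} in
/-- The local ring of the curve at a closed point. -/
abbrev ClosedPoint.O (x : C.ClosedPoint) : Type u := C.LocalRing x.1

variable {C} in
/-- The residue field of the curve at a closed point, an extension of `k`. -/
abbrev ClosedPoint.κ (x : C.ClosedPoint) : Type u := IsLocalRing.ResidueField x.O

/-- The local ring of a smooth curve at a closed point is a discrete valuation ring. -/
instance (x : C.ClosedPoint) : IsDiscreteValuationRing x.O := by
  obtain ⟨x, hx⟩ := x
  obtain ⟨U, hU, V, hV, hxV, e, hs⟩ :=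
    SmoothOfRelativeDimension.exists_isStandardSmoothOfRelativeDimension (n := 1) (f := C.hom) x
  have hUt : U = ⊤ := by
    ext y
    simp only [TopologicalSpace.Opens.coe_top, Set.mem_univ, iff_true]
    exact Subsingleton.elim (C.hom x) y ▸ e hxV
  subst hUt
  have hk := isField_of_isIntegral_of_subsingleton (Spec (CommRingCat.of k))
  algebraize [(C.hom.appLE ⊤ V e).hom]
  have hmax := hV.primeIdealOf_isMaximal_of_isClosed ⟨x, hxV⟩ hx
  have hloc := hV.isLocalization_stalk ⟨x, hxV⟩
  let := TopCat.Presheaf.algebra_section_stalk C.X.presheaf (⟨x, hxV⟩ : V)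
  exact isDVR_of_smooth_dim_one (O := C.LocalRing x) hk
    (hV.primeIdealOf ⟨x, hxV⟩).asIdeal

variable {C}

/-- The normalized multiplicative valuation of the function field at a closed point. -/
def ClosedPoint.valuation (x : C.ClosedPoint) :
    Valuation C.FunctionField (WithZero (Multiplicative ℤ)) :=
  (IsDiscreteValuationRing.maximalIdeal x.O).valuation C.FunctionField

/-- The order of vanishing `ord_x(s)` of a nonzero rational function `s` at a closed point `x`; this
is the coefficient of `x` in the divisor `(s)`. (The value at `s = 0` is irrelevant.) -/
def ClosedPoint.ord (x : C.ClosedPoint) (s : C.FunctionField) : ℤ :=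
  -WithZero.log (x.valuation s)

/-- The subring of the rational functions that are regular at `x`: the image of `O_x` in the function
field. -/
def ClosedPoint.regular (x : C.ClosedPoint) : Subalgebra k C.FunctionField :=
  (IsScalarTower.toAlgHom k x.O C.FunctionField).range

theorem ClosedPoint.le_ord_iff (x : C.ClosedPoint) {s : C.FunctionField} (hs : s ≠ 0) (m : ℤ) :
    m ≤ x.ord s ↔ x.valuation s ≤ WithZero.exp (-m) := by
  rw [ClosedPoint.ord, le_neg, WithZero.log_le_iff_le_exp ((Valuation.ne_zero_iff _).mpr hs)]

theorem ClosedPoint.mem_regular_of_valuation_le_one (x : C.ClosedPoint) {s : C.FunctionField}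
    (hs : x.valuation s ≤ 1) : s ∈ x.regular := by
  obtain ⟨a, ha⟩ := IsDiscreteValuationRing.exists_lift_of_le_one hs
  exact ⟨a, ha⟩

theorem ClosedPoint.valuation_le_one (x : C.ClosedPoint) (a : x.O) :
    x.valuation (algebraMap x.O C.FunctionField a) ≤ 1 :=
  IsDedekindDomain.HeightOneSpectrum.valuation_le_one _ a

theorem ClosedPoint.valuation_smul_le (x : C.ClosedPoint) (c : k) (s : C.FunctionField) :
    x.valuation (c • s) ≤ x.valuation s := by
  rw [Algebra.smul_def, IsScalarTower.algebraMap_apply k x.O C.FunctionField, map_mul]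
  exact mul_le_of_le_one_left' (x.valuation_le_one _)

variable (C)

/-- A divisor on the curve: a finite integral combination of closed points. -/
abbrev Divisor : Type u := C.ClosedPoint →₀ ℤ

variable {C} in
/-- The degree of a divisor, each closed point `x` being counted with weight `[κ(x) : k]`. -/
def Divisor.degree (F : C.Divisor) : ℤ :=
  F.sum fun x m => m * (Module.finrank k x.κ : ℤ)

theorem mem_L_iff_aux (F : C.Divisor) (s : C.FunctionField) :
    (s ≠ 0 → ∀ x : C.ClosedPoint, 0 ≤ x.ord s + F x) ↔
      ∀ x : C.ClosedPoint, x.valuation s ≤ WithZero.exp (F x) := by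
  by_cases hs : s = 0
  · simp [hs]
  · simp only [ne_eq, hs, not_false_eq_true, forall_const]
    refine forall_congr' fun x => ?_
    rw [← neg_le_iff_add_nonneg, x.le_ord_iff hs, neg_neg]

/-- The space `L(F) = Γ(X, O_X(F))` of the rational functions `s` with `s = 0` or `(s) + F ≥ 0`. -/
def L (F : C.Divisor) : Submodule k C.FunctionField where
  carrier := {s | s ≠ 0 → ∀ x : C.ClosedPoint, 0 ≤ x.ord s + F x}
  zero_mem' := fun h => absurd rfl h
  add_mem' {s t} hs ht := by
    simp only [Set.mem_ofPred_eq] at hs ht ⊢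
    rw [mem_L_iff_aux] at hs ht ⊢
    exact fun x => (x.valuation.map_add s t).trans (max_le (hs x) (ht x))
  smul_mem' c s hs := by
    simp only [Set.mem_ofPred_eq] at hs ⊢
    rw [mem_L_iff_aux] at hs ⊢
    exact fun x => (x.valuation_smul_le c s).trans (hs x)

/-- The repartitions (adeles) of the curve: families `(r_x)` of rational functions indexed by the
closed points such that `r_x` is regular at `x` for all but finitely many `x`. -/
def repartition : Submodule k (C.ClosedPoint → C.FunctionField) where
  carrier := {r | {x | r x ∉ x.regular}.Finite}
  zero_mem' := by simp [zero_mem]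
  add_mem' {r s} hr hs := by
    refine (Set.Finite.union hr hs).subset fun x hx => ?_
    by_contra h
    simp only [Set.mem_union, Set.mem_ofPred_eq, not_or, not_not] at h
    exact hx (add_mem h.1 h.2)
  smul_mem' c r hr := by
    refine Set.Finite.subset hr fun x hx h => ?_
    exact hx (Subalgebra.smul_mem _ h c)

/-- The families `(r_x)` with `r_x` regular at `x` for every closed point `x`. -/
def integralRepartition : Submodule k (C.ClosedPoint → C.FunctionField) :=
  Submodule.pi Set.univ fun x => Subalgebra.toSubmodule x.regular

/-- The diagonal embedding of the function field: a rational function as a constant family. -/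
def diagonal : C.FunctionField →ₗ[k] (C.ClosedPoint → C.FunctionField) :=
  LinearMap.pi fun _ => LinearMap.id

/-- The cohomology group `H¹(X, O_X)`, computed from the flasque resolution
`0 → O_X → K → ⨁ₓ (K / O_x) → 0` (`K` the constant sheaf of rational functions and the sum of
skyscraper sheaves over the closed points): the cokernel of `K → ⨁ₓ K / O_x`, that is, the
repartitions modulo the everywhere regular ones and the rational functions. -/
abbrev H1 : Type u :=
  C.repartition ⧸ (C.integralRepartition ⊔ LinearMap.range C.diagonal).comap C.repartition.subtype

/-- The genus `g = dim H¹(X, O_X)`. -/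
def genus : ℕ := Module.finrank k C.H1

/-- The rational points: the closed points `x` with `k ≃ κ(x)`. -/
def RationalPoint : Type u :=
  {x : C.ClosedPoint // Function.Bijective (algebraMap k x.κ)}

variable {C}

/-- The isomorphism `k ≃ κ(x)` at a rational point. -/
def RationalPoint.residueEquiv (x : C.RationalPoint) : k ≃ₐ[k] x.1.κ :=
  AlgEquiv.ofBijective (Algebra.ofId k x.1.κ) x.2

/-- The value `s(x) ∈ k` at a rational point `x` of a rational function `s` regular at `x`: the class
of `s ∈ O_x` in `O_x / m_x ≃ k`. -/
def RationalPoint.eval (x : C.RationalPoint) : x.1.regular →ₐ[k] k :=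
  (x.residueEquiv.symm.toAlgHom.comp (IsScalarTower.toAlgHom k x.1.O x.1.κ)).comp
    (AlgEquiv.ofInjective (IsScalarTower.toAlgHom k x.1.O C.FunctionField)
      (IsFractionRing.injective x.1.O C.FunctionField)).symm.toAlgHom

variable (C)

/-- The divisor `D = p₁ + ⋯ + pₙ`. -/
def pointDivisor {n : ℕ} (p : Fin n → C.RationalPoint) : C.Divisor :=
  ∑ i, Finsupp.single (p i).1 1

theorem mem_support_pointDivisor {n : ℕ} (p : Fin n → C.RationalPoint) (i : Fin n) :
    (p i).1 ∈ (C.pointDivisor p).support := by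
  classical
  rw [Finsupp.mem_support_iff, pointDivisor, Finsupp.finsetSum_apply]
  refine ne_of_gt (Finset.sum_pos' (fun j _ => ?_) ⟨i, Finset.mem_univ i, ?_⟩)
  · rw [Finsupp.single_apply]; split_ifs <;> simp
  · simp

theorem L_le_regular {n : ℕ} (p : Fin n → C.RationalPoint) (G : C.Divisor)
    (hG : Disjoint G.support (C.pointDivisor p).support) (i : Fin n) :
    C.L G ≤ Subalgebra.toSubmodule (p i).1.regular := by
  intro s hs
  have h0 : G (p i).1 = 0 := Finsupp.notMem_support_iff.mp fun h =>
    Finset.disjoint_left.mp hG h (C.mem_support_pointDivisor p i)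
  have h1 := (C.mem_L_iff_aux G s).mp hs (p i).1
  rw [h0, WithZero.exp_zero] at h1
  exact (p i).1.mem_regular_of_valuation_le_one h1

/-- The evaluation map `α : L(G) → kⁿ`, `s ↦ (s(p₁), …, s(pₙ))`. -/
def evaluation {n : ℕ} (p : Fin n → C.RationalPoint) (G : C.Divisor)
    (hG : Disjoint G.support (C.pointDivisor p).support) : C.L G →ₗ[k] (Fin n → k) :=
  LinearMap.pi fun i =>
    (p i).eval.toLinearMap ∘ₗ Submodule.inclusion (C.L_le_regular p G hG i)

/-- The code `C(D, G)`, the image of the evaluation map. For `k = F_q(z)` this is the convolutional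
Goppa code associated with the pair `(D, G)`. -/
def goppaCode {n : ℕ} (p : Fin n → C.RationalPoint) (G : C.Divisor)
    (hG : Disjoint G.support (C.pointDivisor p).support) : Submodule k (Fin n → k) :=
  LinearMap.range (C.evaluation p G hG)

end SmoothProjectiveCurve

end ConvolutionalGoppa

end

/-!
A function in `L(G)` that vanishes at `p₁, …, pₙ` lies in `L(G - D)`, which is zero because
`deg (G - D) = r - n < 0`; so the evaluation map is injective, and the dimension of the code is
`dim L(G) = r + 1 - g`, by Riemann–Roch and the vanishing of `H¹(G)` for `r > 2g - 2`.

Both facts about `L` are proved with adeles. Write `H¹(F)` for the adeles modulo those bounded by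
`F` and the principal ones. The function field is finite over `k(x)` for a transcendental `x`; with
strong approximation away from the poles of `x` and the bound `deg (x)_∞ ≤ [K : k(x)]`, this makes
`H¹(0)` finite-dimensional. Comparing two divisors with their supremum then gives
`dim L(F) - dim H¹(F) = deg F + 1 - g`.

The vanishing theorem needs no duality. A nonzero `s ∈ L(F)` acts as a surjection
`H¹(0) → H¹(F)`. If `H¹(F) ≠ 0`, composing with a nonzero functional on `H¹(F)` thus embeds `L(F)`
in the dual of `H¹(0)`, so `dim L(F) ≤ g`; with `dim L(F) ≥ deg F + 2 - g` this forces
`deg F ≤ 2g - 2`. Divisors of negative degree reduce to this case: a nonzero `s ∈ L(E)` embeds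
`L(F)` in `L(E + F)`, which contradicts Riemann–Roch when `deg E < 0` and `deg F` is large.
-/

noncomputable section

namespace ConvolutionalGoppa

/-! ### Lengths and linear independence -/

section RelLength

variable {R M N : Type*} [Ring R] [AddCommGroup M] [Module R M] [AddCommGroup N] [Module R N]

/-- The length of `B / (A ∩ B)` for submodules `A`, `B` of a module. It is mostly used when `A ≤ B`,
where it is the length of `B / A`. -/
def relLength (A B : Submodule R M) : ℕ∞ :=
  Module.length R (B ⧸ A.comap B.subtype)

theorem relLength_eq_length_of_surjective {A B : Submodule R M} (g : B →ₗ[R] N)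
    (hg : Function.Surjective g) (hker : LinearMap.ker g = A.comap B.subtype) :
    relLength A B = Module.length R N := by
  rw [relLength, ← hker]
  exact (g.quotKerEquivOfSurjective hg).length_eq

theorem relLength_eq_zero_iff {A B : Submodule R M} : relLength A B = 0 ↔ B ≤ A := by
  rw [relLength, Module.length_eq_zero_iff, Submodule.Quotient.subsingleton_iff]
  exact Submodule.comap_subtype_eq_top

theorem relLength_bot (A : Submodule R M) : relLength ⊥ A = Module.length R A :=
  relLength_eq_length_of_surjective LinearMap.id Function.surjective_id (by ext x; simp)

theorem relLength_comap (f : N →ₗ[R] M) (A B : Submodule R M) :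
    relLength (A.comap f) (B.comap f) =
      relLength (A ⊓ LinearMap.range f) (B ⊓ LinearMap.range f) := by
  let f' : B.comap f →ₗ[R] ↥(B ⊓ LinearMap.range f) :=
    f.restrict fun x hx => ⟨hx, LinearMap.mem_range_self f x⟩
  refine relLength_eq_length_of_surjective
    (((A ⊓ LinearMap.range f).comap (B ⊓ LinearMap.range f).subtype).mkQ ∘ₗ f') ?_ ?_
  · refine (Submodule.mkQ_surjective _).comp ?_
    rintro ⟨_, hB, x, rfl⟩
    exact ⟨⟨x, hB⟩, rfl⟩
  · ext x
    exact (Submodule.Quotient.mk_eq_zero _).trans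
      (and_iff_left (LinearMap.mem_range_self f (x : N)))

theorem relLength_sup (A B : Submodule R M) : relLength A (A ⊔ B) = relLength (A ⊓ B) B := by
  let g : B →ₗ[R] (↥(A ⊔ B) ⧸ A.comap (A ⊔ B).subtype) :=
    (A.comap (A ⊔ B).subtype).mkQ ∘ₗ Submodule.inclusion le_sup_right
  refine (relLength_eq_length_of_surjective g ?_ (by ext x; simp [g])).symm
  intro y
  obtain ⟨⟨y, hy⟩, rfl⟩ := Submodule.mkQ_surjective _ y
  obtain ⟨a, ha, b, hb, rfl⟩ := Submodule.mem_sup.mp hy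
  exact ⟨⟨b, hb⟩, (Submodule.Quotient.eq _).mpr (by simpa using ha)⟩

theorem relLength_add {A B C : Submodule R M} (hAB : A ≤ B) (hBC : B ≤ C) :
    relLength A B + relLength B C = relLength A C := by
  let A' : Submodule R C := A.comap C.subtype
  let B' : Submodule R C := B.comap C.subtype
  have hA'B' : A' ≤ B' := Submodule.comap_mono hAB
  let g : B →ₗ[R] B'.map A'.mkQ :=
    (A'.mkQ ∘ₗ Submodule.inclusion hBC).codRestrict _
      fun x => ⟨Submodule.inclusion hBC x, x.2, rfl⟩
  have hg : Function.Surjective g := by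
    rintro ⟨_, x, hx, rfl⟩
    exact ⟨⟨x, hx⟩, rfl⟩
  have hker : LinearMap.ker g = A.comap B.subtype := by
    ext x
    exact Subtype.ext_iff.trans (Submodule.Quotient.mk_eq_zero A')
  rw [relLength_eq_length_of_surjective g hg hker, relLength, relLength,
    ← (Submodule.quotientQuotientEquivQuotient A' B' hA'B').length_eq]
  exact (Module.length_eq_add_of_exact _ _ (Submodule.subtype_injective _)
    (Submodule.mkQ_surjective _) (LinearMap.exact_subtype_mkQ _)).symm

theorem relLength_inf_add_relLength_sup {A B : Submodule R M} (h : A ≤ B) (D : Submodule R M) :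
    relLength (A ⊓ D) (B ⊓ D) + relLength (A ⊔ D) (B ⊔ D) = relLength A B := by
  have hinf : relLength (A ⊓ D) (B ⊓ D) = relLength A (A ⊔ B ⊓ D) := by
    rw [relLength_sup, ← inf_assoc, inf_eq_left.mpr h]
  have hsup : relLength (A ⊔ D) (B ⊔ D) = relLength (A ⊔ B ⊓ D) B := by
    rw [inf_comm B D, ← sup_inf_assoc_of_le D h, ← relLength_sup, sup_right_comm,
      sup_eq_right.mpr h]
  rw [hinf, hsup, relLength_add le_sup_left (sup_le h inf_le_left)]

theorem relLength_iSup_le {A : ℕ → Submodule R M} (hA : Monotone A) {b : ℕ}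
    (hb : ∀ m, relLength (A 0) (A m) ≤ b) : relLength (A 0) (⨆ m, A m) ≤ b := by
  choose a ha using fun m => ENat.ne_top_iff_exists.mp ((hb m).trans_lt (ENat.natCast_lt_top b)).ne
  have hbdd : BddAbove (Set.range a) :=
    ⟨b, by rintro _ ⟨m, rfl⟩; exact_mod_cast (ha m).trans_le (hb m)⟩
  obtain ⟨m₀, hm₀⟩ := Nat.sSup_mem (Set.range_nonempty a) hbdd
  have hle (m : ℕ) : A m ≤ A m₀ := by
    refine (hA (le_max_right m₀ m)).trans (relLength_eq_zero_iff.mp ?_)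
    have hmax : a (max m₀ m) ≤ a m₀ := (le_csSup hbdd (Set.mem_range_self _)).trans_eq hm₀.symm
    have hadd := relLength_add (hA m₀.zero_le) (hA (le_max_left m₀ m))
    rw [← ha, ← ha] at hadd
    refine nonpos_iff_eq_zero.mp ((ENat.add_le_add_iff_left (ENat.natCast_ne_top (a m₀))).mp ?_)
    rw [hadd, add_zero]
    exact_mod_cast hmax
  exact (iSup_le hle).antisymm (le_iSup A m₀) ▸ hb m₀

theorem finite_of_length_ne_top (h : Module.length R M ≠ ⊤) : Module.Finite R M := by
  rw [Module.length_ne_top_iff, isFiniteLength_iff_isNoetherian_isArtinian] at h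
  have := h.1
  infer_instance

end RelLength

theorem card_le_length_of_linearIndependent {k V σ : Type*} [Field k] [AddCommGroup V] [Module k V]
    [Fintype σ] {w : σ → V} (hw : LinearIndependent k w) :
    (Fintype.card σ : ℕ∞) ≤ Module.length k V := by
  rw [Module.length_eq_rank]
  simpa using Cardinal.toENat.monotone' hw.cardinal_lift_le_rank

theorem length_le_of_forall_surjective {k V W W' : Type*} [Field k] [AddCommGroup V] [Module k V]
    [AddCommGroup W] [Module k W] [AddCommGroup W'] [Module k W'] [Nontrivial W']
    [Module.Finite k W] (Φ : V →ₗ[k] W →ₗ[k] W') (hΦ : ∀ v ≠ 0, Function.Surjective (Φ v)) :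
    Module.length k V ≤ Module.length k W := by
  obtain ⟨y, hy⟩ := exists_ne (0 : W')
  obtain ⟨ω, hω⟩ := Module.Projective.exists_dual_ne_zero k hy
  have hinj : Function.Injective (Φ.compr₂ ω) := by
    refine (injective_iff_map_eq_zero _).mpr fun v hv => ?_
    by_contra hv0
    obtain ⟨w, rfl⟩ := hΦ v hv0 y
    exact hω (LinearMap.congr_fun hv w)
  calc Module.length k V ≤ Module.length k (Module.Dual k W) := Module.length_le_of_injective _ hinj
    _ = Module.length k W := by
      rw [Module.length_eq_finrank, Module.length_eq_finrank, Subspace.dual_finrank_eq]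

section AdjoinSimple

open IntermediateField Polynomial

open algebraAdjoinAdjoin in
theorem linearIndependent_adjoin_simple_iff {k K σ : Type*} [Field k] [Field K] [Algebra k K]
    [Fintype σ] {x : K} {w : σ → K} :
    LinearIndependent k⟮x⟯ w ↔
      ∀ p : σ → k[X], ∑ j, aeval x (p j) * w j = 0 → ∀ j, aeval x (p j) = 0 := by
  rw [← LinearIndependent.iff_fractionRing (Algebra.adjoin k {x}) k⟮x⟯,
    Fintype.linearIndependent_iff]
  refine ⟨fun h p hp j => ?_, fun h g hg j => ?_⟩
  · exact congrArg Subtype.val (h (fun j => ⟨aeval x (p j), aeval_mem_adjoin_singleton k x⟩) hp j)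
  · have hpoly (j : σ) : ∃ p : k[X], aeval x p = (g j : K) :=
      (Algebra.adjoin_singleton_eq_range_aeval k x).le (g j).2
    choose p hp using hpoly
    refine Subtype.ext ((hp j).symm.trans (h p ?_ j))
    simp only [hp]
    exact hg

theorem linearIndependent_pow_mul {k K σ : Type*} [Field k] [Field K] [Algebra k K] {x : K}
    (hx : Transcendental k x) {w : σ → K} (hw : LinearIndependent k⟮x⟯ w) :
    LinearIndependent k fun p : ℕ × σ => x ^ p.1 * w p.2 := by
  have hgen : Transcendental k (AdjoinSimple.gen k x) := by
    rwa [← transcendental_algebraMap_iff (algebraMap k⟮x⟯ K).injective]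
  have hpow := (basisMonomials k).linearIndependent.map'
    (aeval (AdjoinSimple.gen k x)).toLinearMap
    (LinearMap.ker_eq_bot.mpr (transcendental_iff_injective.mp hgen))
  simpa [Function.comp_def, Algebra.smul_def] using linearIndependent_smul hpow hw

end AdjoinSimple

/-! ### Discrete valuations -/

section DiscreteValuation

open WithZero NNReal Filter

/-- The ball `{s | v s ≤ exp m}` of a discrete valuation that is trivial on `k`. -/
def valuationBall {k K : Type*} [Field k] [Field K] [Algebra k K] (v : Valuation K ℤᵐ⁰)
    (hv : ∀ c : k, v (algebraMap k K c) ≤ 1) (m : ℤ) : Submodule k K where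
  carrier := {s | v s ≤ exp m}
  zero_mem' := by simp
  add_mem' {s t} hs ht := (v.map_add s t).trans (max_le hs ht)
  smul_mem' c s hs := by
    rw [Set.mem_ofPred_eq, Algebra.smul_def, map_mul]
    exact (mul_le_of_le_one_left' (hv c)).trans hs

theorem eventually_val_pow_mul_lt_one {K : Type*} [Field K] (v : Valuation K ℤᵐ⁰) {a : K}
    (ha : v a < 1) (b : K) : ∀ᶠ m : ℕ in atTop, v (a ^ m * b) < 1 := by
  rcases eq_or_ne b 0 with rfl | hb
  · simp
  have hvb : v b ≠ 0 := (Valuation.ne_zero_iff v).mpr hb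
  obtain ⟨n, hn⟩ := exists_pow_lt₀ ha (Units.mk0 (v b) hvb)⁻¹
  filter_upwards [eventually_ge_atTop n] with m hm
  rw [map_mul, map_pow, ← lt_mul_inv_iff₀ (zero_lt_iff.mpr hvb), one_mul]
  exact (pow_le_pow_right_of_le_one' ha.le hm).trans_lt hn

/-- The real absolute value `2 ^ log (v x)` attached to a discrete valuation `v`. -/
def discreteAbv {K : Type*} [Field K] (v : Valuation K ℤᵐ⁰) : AbsoluteValue K ℝ where
  toFun x := WithZeroMulInt.toNNReal (two_ne_zero : (2 : ℝ≥0) ≠ 0) (v x)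
  map_mul' _ _ := by simp
  nonneg' _ := NNReal.zero_le_coe
  eq_zero' _ := by simp
  add_le' x y := by
    have hmono := (WithZeroMulInt.toNNReal_strictMono (one_lt_two (α := ℝ≥0))).monotone
    have h := hmono (v.map_add x y)
    rw [hmono.map_max] at h
    exact_mod_cast h.trans (max_le_add_of_nonneg zero_le zero_le)

theorem discreteAbv_le_iff {K : Type*} [Field K] {v : Valuation K ℤᵐ⁰} {x y : K} :
    discreteAbv v x ≤ discreteAbv v y ↔ v x ≤ v y :=
  NNReal.coe_le_coe.trans (WithZeroMulInt.toNNReal_strictMono (one_lt_two (α := ℝ≥0))).le_iff_le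

theorem discreteAbv_lt_iff {K : Type*} [Field K] {v : Valuation K ℤᵐ⁰} {x y : K} :
    discreteAbv v x < discreteAbv v y ↔ v x < v y :=
  lt_iff_lt_of_le_iff_le discreteAbv_le_iff

theorem isNontrivial_discreteAbv {K : Type*} [Field K] {v : Valuation K ℤᵐ⁰}
    (hv : ∃ s, v s = exp (-1)) : (discreteAbv v).IsNontrivial := by
  obtain ⟨s, hs⟩ := hv
  refine ⟨s, fun h => exp_ne_zero (M := ℤ) (hs.symm.trans (by rw [h, map_zero])), ?_⟩
  rw [← map_one (discreteAbv v)]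
  refine (discreteAbv_lt_iff.mpr ?_).ne
  rw [hs, map_one, ← exp_zero, exp_lt_exp]
  norm_num

theorem not_isEquiv_discreteAbv {K : Type*} [Field K] {v v' : Valuation K ℤᵐ⁰}
    (h : ∃ s, v s ≤ 1 ∧ 1 < v' s) : ¬ (discreteAbv v).IsEquiv (discreteAbv v') := by
  intro he
  obtain ⟨s, hs, hs'⟩ := h
  rw [← map_one v, ← discreteAbv_le_iff] at hs
  rw [← map_one v'] at hs'
  exact hs'.not_ge (discreteAbv_le_iff.mp ((he s 1).mp hs))

theorem exists_valuation_eq_exp {K : Type*} [Field K] {v : Valuation K ℤᵐ⁰}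
    (hv : ∃ s, v s = exp (-1)) (m : ℤ) : ∃ t, v t = exp m := by
  obtain ⟨s, hs⟩ := hv
  exact ⟨s ^ (-m), by rw [map_zpow₀, hs, ← exp_zsmul]; simp⟩

theorem exists_forall_valuation_sub_le {K ι : Type*} [Field K] [Finite ι]
    {v : ι → Valuation K ℤᵐ⁰} (hv : Pairwise fun i j => ∃ s, v i s ≤ 1 ∧ 1 < v j s)
    (hnt : ∀ i, ∃ s, v i s = exp (-1)) (r : ι → K) (m : ι → ℤ) :
    ∃ f : K, ∀ i, v i (f - r i) ≤ exp (m i) := by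
  have := Fintype.ofFinite ι
  obtain ⟨m₀, hm₀⟩ := Finite.exists_ge m
  choose t ht using fun i => exists_valuation_eq_exp (hnt i) m₀
  have hpos : 0 < (WithZeroMulInt.toNNReal (two_ne_zero : (2 : ℝ≥0) ≠ 0) (exp m₀) : ℝ) :=
    NNReal.coe_pos.mpr (WithZeroMulInt.toNNReal_pos _ exp_ne_zero)
  obtain ⟨f, hf⟩ := Metric.denseRange_iff.mp
    (AbsoluteValue.denseRange_algebraMap_pi (fun i => isNontrivial_discreteAbv (hnt i))
      fun _ _ hij => not_isEquiv_discreteAbv (hv hij))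
    (fun i => WithAbs.toAbs (discreteAbv (v i)) (r i)) _ hpos
  refine ⟨f, fun i => le_trans ?_ (exp_le_exp.mpr (hm₀ i))⟩
  have hi := (dist_pi_lt_iff hpos).mp hf i
  rw [dist_comm, dist_eq_norm, ← ht i] at hi
  rw [← ht i]
  exact (discreteAbv_lt_iff.mp hi).le

end DiscreteValuation

/-! ### Riemann–Roch for a system of places -/

open WithZero in
/-- The places of a complete curve with function field `K` over `k`: discrete valuations of `K`,
trivial on `k` and pairwise incomparable, with residue fields of finite degree over `k`, such that
every function has finitely many poles and only the constants have none. The index type `ι` plays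
the role of the set of closed points, and divisors are the elements of `ι →₀ ℤ`. -/
structure PlaceSystem (k K ι : Type*) [Field k] [Field K] [Algebra k K] where
  /-- the normalized valuations -/
  val : ι → Valuation K ℤᵐ⁰
  /-- the degrees of the residue fields -/
  residueDegree : ι → ℕ
  val_algebraMap_le_one : ∀ i (c : k), val i (algebraMap k K c) ≤ 1
  exists_val_eq_exp_neg_one : ∀ i, ∃ t, val i t = exp (-1)
  finite_poles : ∀ s, {i | 1 < val i s}.Finite
  relLength_residue : ∀ i, relLength (valuationBall (val i) (val_algebraMap_le_one i) (-1))
    (valuationBall (val i) (val_algebraMap_le_one i) 0) = residueDegree i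
  incomparable : Pairwise fun i j => ∃ s, val i s ≤ 1 ∧ 1 < val j s
  mem_range_of_forall_val_le_one : ∀ s, (∀ i, val i s ≤ 1) → s ∈ Set.range (algebraMap k K)

namespace PlaceSystem

open WithZero Polynomial IntermediateField Filter nonZeroDivisors

variable {k K ι : Type*} [Field k] [Field K] [Algebra k K] (S : PlaceSystem k K ι)

/-- The functions with a pole of order at most `m` at the place `i`. -/
abbrev ball (i : ι) (m : ℤ) : Submodule k K :=
  valuationBall (S.val i) (S.val_algebraMap_le_one i) m

/-- The adeles, or repartitions: the families of functions that are regular at almost all places. -/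
def adele : Submodule k (ι → K) where
  carrier := {r | {i | 1 < S.val i (r i)}.Finite}
  zero_mem' := by simp
  add_mem' {r s} hr hs := by
    refine (Set.Finite.union hr hs).subset fun i hi => ?_
    exact lt_max_iff.mp (lt_of_lt_of_le hi ((S.val i).map_add _ _))
  smul_mem' c r hr := by
    refine Set.Finite.subset hr fun i (hi : 1 < S.val i (c • r i)) => hi.trans_le ?_
    rw [Algebra.smul_def, map_mul]
    exact mul_le_of_le_one_left' (S.val_algebraMap_le_one i c)

/-- The diagonal embedding of the function field into the families of functions. -/
def diagonal (_ : PlaceSystem k K ι) : K →ₗ[k] (ι → K) :=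
  LinearMap.pi fun _ => LinearMap.id

/-- The principal adeles. -/
abbrev principal : Submodule k (ι → K) := LinearMap.range S.diagonal

/-- The adeles whose poles are bounded by a divisor. -/
def boundedAdele (F : ι →₀ ℤ) : Submodule k (ι → K) :=
  Submodule.pi Set.univ fun i => S.ball i (F i)

/-- The degree of a divisor, each place being counted with the degree of its residue field. -/
def degree : (ι →₀ ℤ) →+ ℤ :=
  Finsupp.liftAddHom fun i => AddMonoidHom.mulRight (S.residueDegree i : ℤ)

variable {S}

theorem mem_boundedAdele {F : ι →₀ ℤ} {r : ι → K} :
    r ∈ S.boundedAdele F ↔ ∀ i, S.val i (r i) ≤ exp (F i) := by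
  simp only [boundedAdele, Submodule.mem_pi, Set.mem_univ, forall_const]
  rfl

variable (S)

theorem principal_le_adele : S.principal ≤ S.adele := by
  rintro _ ⟨s, rfl⟩
  exact S.finite_poles s

theorem boundedAdele_le_adele (F : ι →₀ ℤ) : S.boundedAdele F ≤ S.adele := fun r hr => by
  refine F.hasFiniteSupport.subset fun i (hi : 1 < S.val i (r i)) hFi => ?_
  have hle := mem_boundedAdele.mp hr i
  rw [hFi, exp_zero] at hle
  exact hi.not_ge hle

theorem boundedAdele_mono : Monotone S.boundedAdele := fun _ _ h _ hr =>
  mem_boundedAdele.mpr fun i => (mem_boundedAdele.mp hr i).trans (exp_le_exp.mpr (h i))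

theorem degree_apply (F : ι →₀ ℤ) : S.degree F = F.sum fun i m => m * S.residueDegree i := rfl

theorem degree_nonneg {F : ι →₀ ℤ} (hF : 0 ≤ F) : 0 ≤ S.degree F :=
  Finset.sum_nonneg fun i _ => mul_nonneg (hF i) (Int.natCast_nonneg _)

theorem relLength_ball_add_one (i : ι) (m : ℤ) :
    relLength (S.ball i m) (S.ball i (m + 1)) = S.residueDegree i := by
  obtain ⟨t, ht⟩ := exists_valuation_eq_exp (S.exists_val_eq_exp_neg_one i) (-(m + 1))
  have ht0 : t ≠ 0 := fun h => exp_ne_zero (M := ℤ) (ht.symm.trans (by rw [h, map_zero]))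
  have hball (l : ℤ) : (S.ball i l).comap (LinearMap.mulLeft k t) = S.ball i (l + (m + 1)) := by
    ext s
    change S.val i (t * s) ≤ exp l ↔ S.val i s ≤ exp (l + (m + 1))
    rw [map_mul, ht, exp_neg, inv_mul_le_iff₀ exp_pos, ← exp_add, add_comm]
  have hrange : LinearMap.range (LinearMap.mulLeft k t) = ⊤ :=
    LinearMap.range_eq_top.mpr (mul_left_surjective₀ ht0)
  have hcomap := relLength_comap (LinearMap.mulLeft k t) (S.ball i (-1)) (S.ball i 0)
  rw [hball, hball, hrange, inf_top_eq, inf_top_eq, S.relLength_residue] at hcomap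
  rwa [neg_add_cancel_comm_assoc, zero_add] at hcomap

theorem relLength_ball_add (i : ι) (m : ℤ) (n : ℕ) :
    relLength (S.ball i m) (S.ball i (m + n)) = n * S.residueDegree i := by
  have hmono {a b : ℤ} (hab : a ≤ b) : S.ball i a ≤ S.ball i b :=
    fun s (hs : S.val i s ≤ exp a) => hs.trans (exp_le_exp.mpr hab)
  induction n with
  | zero => simp [relLength_eq_zero_iff]
  | succ n ih =>
    rw [← relLength_add (hmono (a := m) (b := m + n) (by simp)) (hmono (by simp)), ih,
      Nat.cast_succ, ← add_assoc, relLength_ball_add_one, Nat.cast_succ, add_one_mul]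

theorem relLength_boundedAdele_add_single (F : ι →₀ ℤ) (i : ι) (n : ℕ) :
    relLength (S.boundedAdele F) (S.boundedAdele (F + Finsupp.single i (n : ℤ))) =
      n * S.residueDegree i := by
  classical
  have happly : (F + Finsupp.single i (n : ℤ)) i = F i + n := by simp
  let B : Submodule k K := S.ball i (F i + n)
  let A : Submodule k B := (S.ball i (F i)).comap B.subtype
  let f : S.boundedAdele (F + Finsupp.single i (n : ℤ)) →ₗ[k] B :=
    (LinearMap.proj i).restrict fun r hr =>
      (mem_boundedAdele.mp hr i).trans_eq (congrArg exp happly)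
  rw [← S.relLength_ball_add i (F i)]
  refine relLength_eq_length_of_surjective (A.mkQ ∘ₗ f) (A.mkQ_surjective.comp ?_) ?_
  · rintro ⟨a, ha⟩
    have hsingle : Pi.single i a ∈ S.boundedAdele (F + Finsupp.single i (n : ℤ)) := by
      refine mem_boundedAdele.mpr fun j => ?_
      rcases eq_or_ne j i with rfl | hj
      · rwa [Pi.single_eq_same, happly]
      · simp [Pi.single_eq_of_ne hj]
    exact ⟨⟨_, hsingle⟩, Subtype.ext (Pi.single_eq_same (M := fun _ => K) i a)⟩
  · ext ⟨r, hr⟩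
    refine (Submodule.Quotient.mk_eq_zero A).trans (Iff.trans ?_ mem_boundedAdele.symm)
    refine ⟨fun h j => ?_, fun h => h i⟩
    rcases eq_or_ne j i with rfl | hj
    · exact h
    · simpa [Finsupp.single_eq_of_ne hj] using mem_boundedAdele.mp hr j

theorem relLength_boundedAdele {F G : ι →₀ ℤ} (h : F ≤ G) :
    relLength (S.boundedAdele F) (S.boundedAdele G) = (S.degree (G - F)).toNat := by
  classical
  obtain ⟨E, rfl⟩ := exists_add_of_le h
  have hE : 0 ≤ E := nonneg_of_le_add_right h
  rw [add_sub_cancel_left]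
  clear h
  induction E using Finsupp.induction generalizing F with
  | zero => simp [relLength_eq_zero_iff]
  | single_add i m E hi hm ih =>
    have hEi : E i = 0 := Finsupp.notMem_support_iff.mp hi
    have hm0 : 0 ≤ m := by simpa [hEi] using hE i
    have hE0 : 0 ≤ E := fun j => by
      rcases eq_or_ne j i with rfl | hj
      · exact hEi.ge
      · simpa [Finsupp.single_eq_of_ne hj] using hE j
    lift m to ℕ using hm0
    have hsingle : S.degree (Finsupp.single i (m : ℤ)) = m * S.residueDegree i := by
      simp [degree_apply]
    rw [map_add, hsingle, Int.toNat_add (by positivity) (S.degree_nonneg hE0), ← add_assoc,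
      ← relLength_add (S.boundedAdele_mono (le_add_of_nonneg_right (by simp)))
        (S.boundedAdele_mono (le_add_of_nonneg_right hE0)),
      relLength_boundedAdele_add_single, ih hE0]
    push_cast
    rfl

theorem val_aeval_le_one {i : ι} {y : K} (hy : S.val i y ≤ 1) (q : k[X]) :
    S.val i (aeval y q) ≤ 1 := by
  induction q using Polynomial.induction_on' with
  | add p q hp hq =>
    rw [map_add]
    exact ((S.val i).map_add _ _).trans (max_le hp hq)
  | monomial n a =>
    rw [aeval_monomial, map_mul, map_pow]
    exact mul_le_one' (S.val_algebraMap_le_one i a) (pow_le_one' hy n)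

theorem exists_val_aeval_lt_one {i : ι} {y : K} (hy : S.val i y ≤ 1) :
    ∃ q ∈ k[X]⁰, S.val i (aeval y q) < 1 := by
  let m : Submodule k (S.ball i 0) := (S.ball i (-1)).comap (S.ball i 0).subtype
  have hfinite : Module.Finite k (S.ball i 0 ⧸ m) := by
    refine finite_of_length_ne_top ?_
    rw [show Module.length k _ = _ from S.relLength_residue i]
    exact ENat.natCast_ne_top _
  let residue : k[X] →ₗ[k] S.ball i 0 ⧸ m :=
    m.mkQ ∘ₗ (aeval y).toLinearMap.codRestrict (S.ball i 0) (S.val_aeval_le_one hy)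
  have hresidue : ¬ Function.Injective residue := fun h =>
    Polynomial.not_finite (R := k) (Module.Finite.of_injective residue h)
  rw [injective_iff_map_eq_zero] at hresidue
  push Not at hresidue
  obtain ⟨q, hq, hq0⟩ := hresidue
  have hle : S.val i (aeval y q) ≤ exp (-1) := (Submodule.Quotient.mk_eq_zero m).mp hq
  refine ⟨q, mem_nonZeroDivisors_of_ne_zero hq0, hle.trans_lt ?_⟩
  rw [← exp_zero, exp_lt_exp]
  norm_num

theorem exists_val_aeval_lt_one_of_val_eq_one {i : ι} {y : K} (hy : S.val i y = 1) :
    ∃ q ∈ MonoidHom.mker (constantCoeff (R := k)), S.val i (aeval y q) < 1 := by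
  obtain ⟨q, hq0, hq⟩ := S.exists_val_aeval_lt_one hy.le
  obtain ⟨q', hqq', hq'⟩ :=
    exists_eq_pow_rootMultiplicity_mul_and_not_dvd q (nonZeroDivisors.ne_zero hq0) 0
  rw [C_0, sub_zero] at hqq' hq'
  rw [X_dvd_iff] at hq'
  refine ⟨C (q'.coeff 0)⁻¹ * q', by simp [MonoidHom.mem_mker, hq'], ?_⟩
  rw [hqq', map_mul, map_mul, map_pow, map_pow, aeval_X, hy, one_pow, one_mul] at hq
  rw [map_mul, map_mul, aeval_C]
  exact (mul_le_of_le_one_left' (S.val_algebraMap_le_one i _)).trans_lt hq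

theorem exists_forall_val_aeval_mul_lt_one {M : Submonoid k[X]} {y : K} {T : Finset ι}
    (hy : ∀ i ∈ T, S.val i y ≤ 1) (hM : ∀ i ∈ T, ∃ q ∈ M, S.val i (aeval y q) < 1) (f : K) :
    ∃ q ∈ M, ∀ i ∈ T, S.val i (aeval y q * f) < 1 := by
  classical
  induction T using Finset.induction_on with
  | empty => exact ⟨1, one_mem M, by simp⟩
  | insert i T _ ih =>
    rw [Finset.forall_mem_insert] at hy hM
    obtain ⟨q, hqM, hq⟩ := ih hy.2 hM.2
    obtain ⟨p, hpM, hp⟩ := hM.1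
    obtain ⟨m, hm⟩ := (eventually_val_pow_mul_lt_one (S.val i) hp f).exists
    refine ⟨p ^ m * q, mul_mem (pow_mem hpM m) hqM, Finset.forall_mem_insert _ _ _ |>.mpr
      ⟨?_, fun j hj => ?_⟩⟩
    · rw [map_mul (aeval y), map_pow, mul_right_comm, map_mul]
      exact (mul_le_of_le_one_right' (S.val_aeval_le_one hy.1 q)).trans_lt hm
    · rw [map_mul (aeval y), mul_assoc, map_mul]
      exact (mul_le_of_le_one_left' (S.val_aeval_le_one (hy.2 j hj) _)).trans_lt (hq j hj)

theorem exists_val_one_sub_aeval_mul_le_one {y : K} {T T' : Finset ι}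
    (hT : ∀ i ∈ T, S.val i y < 1) (hT' : ∀ i ∈ T', S.val i y = 1) (f : K) :
    ∃ e : k[X], (∀ i ∈ T, S.val i ((1 - aeval y e) * f) ≤ 1) ∧
      ∀ i ∈ T', S.val i (aeval y e * f) ≤ 1 := by
  -- Take `e = 1 - (1 - q) ^ m`, where `q(0) = 1` and `q(y)` is small on `T'`: it is a multiple of
  -- `q`, while `1 - q` is a multiple of `X`, so `(1 - q(y)) ^ m` is small on `T`.
  obtain ⟨q, hq1, hq⟩ := S.exists_forall_val_aeval_mul_lt_one (fun i hi => (hT' i hi).le)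
    (fun i hi => S.exists_val_aeval_lt_one_of_val_eq_one (hT' i hi)) f
  obtain ⟨q', hq'⟩ : X ∣ 1 - q := by
    rw [X_dvd_iff, coeff_sub, coeff_one_zero, ← constantCoeff_apply, MonoidHom.mem_mker.mp hq1,
      sub_self]
  have hone_sub : ∀ i ∈ T, S.val i (aeval y (1 - q)) < 1 := fun i hi => by
    rw [hq', map_mul, aeval_X, map_mul]
    exact (mul_le_of_le_one_right' (S.val_aeval_le_one (hT i hi).le _)).trans_lt (hT i hi)
  obtain ⟨m, hm⟩ := ((eventually_all_finset T).mpr fun i hi =>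
    eventually_val_pow_mul_lt_one (S.val i) (hone_sub i hi) f).exists
  refine ⟨1 - (1 - q) ^ m, fun i hi => ?_, fun i hi => ?_⟩
  · rw [map_sub, map_one, sub_sub_cancel, map_pow]
    exact (hm i hi).le
  · obtain ⟨a, ha⟩ : q ∣ 1 - (1 - q) ^ m := by simpa using sub_dvd_pow_sub_pow 1 (1 - q) m
    rw [ha, map_mul (aeval y), mul_right_comm, map_mul]
    exact mul_le_one' (hq i hi).le (S.val_aeval_le_one (hT' i hi).le _)

theorem weak_approximation (T : Finset ι) (r : ι → K) (m : ι → ℤ) :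
    ∃ f : K, ∀ i ∈ T, S.val i (f - r i) ≤ exp (m i) := by
  obtain ⟨f, hf⟩ := exists_forall_valuation_sub_le (v := fun i : T => S.val i)
    (fun i j hij => S.incomparable (Subtype.coe_injective.ne hij))
    (fun i => S.exists_val_eq_exp_neg_one i) (fun i => r i) (fun i => m i)
  exact ⟨f, fun i hi => hf ⟨i, hi⟩⟩

theorem finite_setOf_val_lt_one {y : K} (hy : y ≠ 0) : {i | S.val i y < 1}.Finite :=
  (S.finite_poles y⁻¹).subset fun i hi => by
    rw [Set.mem_ofPred_eq, map_inv₀]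
    exact (one_lt_inv₀ (zero_lt_iff.mpr ((Valuation.ne_zero_iff _).mpr hy))).mpr hi

theorem strong_approximation {x : K} (hx : Transcendental k x) {r : ι → K} (hr : r ∈ S.adele) :
    ∃ f : K, ∀ i, S.val i x ≤ 1 → S.val i (r i - f) ≤ 1 := by
  have hbad : {i | S.val i x ≤ 1 ∧ 1 < S.val i (r i)}.Finite := hr.subset fun i hi => hi.2
  obtain ⟨h, hh0, hh⟩ := S.exists_forall_val_aeval_mul_lt_one (T := hbad.toFinset)
    (fun i hi => (hbad.mem_toFinset.mp hi).1)
    (fun i hi => S.exists_val_aeval_lt_one (hbad.mem_toFinset.mp hi).1) 1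
  have hy0 : aeval x h ≠ 0 := fun h0 =>
    nonZeroDivisors.ne_zero hh0 (transcendental_iff.mp hx h h0)
  set y := aeval x h
  have hzeros := S.finite_setOf_val_lt_one hy0
  obtain ⟨f, hf⟩ := S.weak_approximation hzeros.toFinset r 0
  have hpoles : {i | S.val i y = 1 ∧ 1 < S.val i f}.Finite :=
    (S.finite_poles f).subset fun i hi => hi.2
  obtain ⟨e, he, he'⟩ := S.exists_val_one_sub_aeval_mul_le_one
    (fun i hi => hzeros.mem_toFinset.mp hi) (fun i hi => (hpoles.mem_toFinset.mp hi).1) f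
  refine ⟨aeval y e * f, fun i hi => ?_⟩
  rcases (S.val_aeval_le_one hi h).lt_or_eq with hlt | heq
  · have hiT := hzeros.mem_toFinset.mpr hlt
    rw [show r i - aeval y e * f = (1 - aeval y e) * f - (f - r i) by ring]
    exact ((S.val i).map_sub _ _).trans (max_le (he i hiT) (hf i hiT))
  · have hri : S.val i (r i) ≤ 1 := not_lt.mp fun hcon => by
      have hlt := hh i (hbad.mem_toFinset.mpr ⟨hi, hcon⟩)
      rw [mul_one] at hlt
      exact hlt.ne heq
    refine ((S.val i).map_sub _ _).trans (max_le hri ?_)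
    rcases le_or_gt (S.val i f) 1 with hfi | hfi
    · rw [map_mul]
      exact mul_le_one' (S.val_aeval_le_one heq.le _) hfi
    · exact he' i (hpoles.mem_toFinset.mpr ⟨heq, hfi⟩)

/-- The divisor of poles of a function. -/
def poleDivisor (x : K) : ι →₀ ℤ :=
  Finsupp.onFinset (S.finite_poles x).toFinset (fun i => max 0 (log (S.val i x))) fun i hi => by
    rw [Set.Finite.mem_toFinset, Set.mem_ofPred_eq]
    contrapose! hi
    refine max_eq_left ?_
    rcases eq_or_ne (S.val i x) 0 with h0 | h0
    · rw [h0, log_zero]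
    · rwa [log_le_iff_le_exp h0, exp_zero]

theorem poleDivisor_nonneg (x : K) : 0 ≤ S.poleDivisor x := fun _ => le_max_left _ _

theorem val_le_exp_poleDivisor (x : K) (i : ι) : S.val i x ≤ exp (S.poleDivisor x i) :=
  le_exp_of_log_le (le_max_right _ _)

theorem one_le_poleDivisor {x : K} {i : ι} (h : 1 < S.val i x) : 1 ≤ S.poleDivisor x i :=
  exp_lt_exp.mp (exp_zero.trans_lt (h.trans_le (S.val_le_exp_poleDivisor x i)))

theorem val_eq_exp_poleDivisor {x : K} {i : ι} (h : 1 < S.val i x) :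
    S.val i x = exp (S.poleDivisor x i) := by
  have h0 : S.val i x ≠ 0 := (zero_lt_one.trans h).ne'
  have hlog : 0 ≤ log (S.val i x) := by rw [le_log_iff_exp_le h0, exp_zero]; exact h.le
  exact (exp_log h0).symm.trans (congrArg exp (max_eq_right hlog).symm)

theorem one_lt_val_of_mem_support_poleDivisor {x : K} {i : ι}
    (hi : i ∈ (S.poleDivisor x).support) : 1 < S.val i x :=
  (S.finite_poles x).mem_toFinset.mp (Finsupp.support_onFinset_subset hi)

theorem val_aeval_mul_le {x : K} {i : ι} (h : 1 ≤ S.val i x) {d : ℕ} {p : k[X]}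
    (hp : p.degree < d) : S.val i (aeval x p) * S.val i x ≤ S.val i x ^ d := by
  rcases eq_or_ne p 0 with rfl | hp0
  · simp
  have hd : p.natDegree < d := (natDegree_lt_iff_degree_lt hp0).mpr hp
  rw [← map_mul, aeval_eq_sum_range' hd, Finset.sum_mul]
  refine (S.val i).map_sum_le fun e he => ?_
  rw [Algebra.smul_def, mul_assoc, map_mul, ← pow_succ, map_pow]
  exact (mul_le_of_le_one_left' (S.val_algebraMap_le_one i _)).trans
    (pow_le_pow_right₀ h (Finset.mem_range.mp he))

theorem val_sum_coeff_smul_mul_le_one {σ : Type*} [Fintype σ] {x : K} {i : ι}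
    (hx : 1 ≤ S.val i x) {w : σ → K} (hw : ∀ j, S.val i (w j) ≤ 1) {d : ℕ} {p : σ → k[X]}
    (hp : ∀ j, (p j).natDegree ≤ d) (hsum : ∑ j, aeval x (p j) * w j = 0) :
    S.val i (∑ j, (p j).coeff d • w j) * S.val i x ≤ 1 := by
  have herase (j : σ) : ((p j).erase d).degree < d := by
    rw [degree_lt_iff_coeff_zero]
    intro e he
    rcases he.eq_or_lt with rfl | he
    · exact erase_same _ _
    · rw [erase_ne _ he.ne', coeff_eq_zero_of_natDegree_lt ((hp j).trans_lt he)]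
  have hlead : x ^ d * ∑ j, (p j).coeff d • w j = -∑ j, aeval x ((p j).erase d) * w j := by
    rw [eq_neg_iff_add_eq_zero, ← hsum, Finset.mul_sum, ← Finset.sum_add_distrib]
    refine Finset.sum_congr rfl fun j _ => ?_
    conv_rhs => rw [← monomial_add_erase (p j) d, map_add, aeval_monomial, add_mul]
    rw [Algebra.smul_def]
    ring
  have hle : S.val i (x ^ d * ∑ j, (p j).coeff d • w j) * S.val i x ≤ S.val i x ^ d := by
    rw [hlead, Valuation.map_neg, ← map_mul, Finset.sum_mul]
    refine (S.val i).map_sum_le fun j _ => ?_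
    rw [mul_right_comm, map_mul, map_mul]
    exact (mul_le_of_le_one_right' (hw j)).trans (S.val_aeval_mul_le hx (herase j))
  rw [map_mul, map_pow, mul_assoc] at hle
  have hpos : 0 < S.val i x ^ d := pow_pos (zero_lt_one.trans_le hx) d
  exact le_of_mul_le_mul_left (hle.trans_eq (mul_one _).symm) hpos

theorem linearIndependent_adjoin_of_residues {σ : Type*} [Fintype σ] {x : K} {w : σ → K}
    (hw : ∀ j i, 1 < S.val i x → S.val i (w j) ≤ 1)
    (hindep : ∀ c : σ → k, (∀ i, 1 < S.val i x →
      S.val i (∑ j, c j • w j) * S.val i x ≤ 1) → c = 0) :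
    LinearIndependent k⟮x⟯ w := by
  rw [linearIndependent_adjoin_simple_iff]
  intro p hsum
  -- Divided by `x ^ d`, a relation of degree at most `d` bounds the combination of its coefficients
  -- of degree `d` at the poles of `x`, so these vanish, from the top degree downwards.
  suffices hp : ∀ (d : ℕ) (j : σ), (p j).coeff d = 0 from fun j => by
    rw [show p j = 0 from Polynomial.ext (hp · j), map_zero]
  obtain ⟨b, hb⟩ := Finite.bddAbove_range fun j => (p j).natDegree
  replace hb (j : σ) : (p j).natDegree ≤ b := hb ⟨j, rfl⟩
  refine Nat.strong_decreasing_induction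
    ⟨b, fun d hd j => coeff_eq_zero_of_natDegree_lt ((hb j).trans_lt hd)⟩ fun d hd => ?_
  have hdeg (j : σ) : (p j).natDegree ≤ d := natDegree_le_iff_coeff_eq_zero.mpr (hd · · j)
  exact congrFun (hindep _ fun i hi =>
    S.val_sum_coeff_smul_mul_le_one hi.le (hw · i hi) hdeg hsum)

theorem exists_independent_mod_divisor (E : ι →₀ ℤ) (hE : 0 ≤ E) :
    ∃ w : Fin (S.degree E).toNat → K, (∀ j, ∀ i ∈ E.support, S.val i (w j) ≤ 1) ∧
      ∀ c : Fin (S.degree E).toNat → k,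
        (∀ i ∈ E.support, S.val i (∑ j, c j • w j) ≤ exp (-E i)) → c = 0 := by
  have hlen := S.relLength_boundedAdele (neg_nonpos.mpr hE)
  rw [zero_sub, neg_neg] at hlen
  let N := (S.boundedAdele (-E)).comap (S.boundedAdele 0).subtype
  change Module.length k (S.boundedAdele 0 ⧸ N) = _ at hlen
  have hfinite : Module.Finite k (S.boundedAdele 0 ⧸ N) :=
    finite_of_length_ne_top (hlen ▸ ENat.natCast_ne_top _)
  rw [Module.length_eq_finrank, Nat.cast_inj] at hlen
  let b := Module.finBasisOfFinrankEq k _ hlen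
  choose r hr using fun j => Submodule.Quotient.mk_surjective N (b j)
  choose w hw using fun j => S.weak_approximation E.support (r j : ι → K) (-E)
  refine ⟨w, fun j i hi => ?_, fun c hc => ?_⟩
  · rw [← sub_add_cancel (w j) ((r j : ι → K) i)]
    refine ((S.val i).map_add _ _).trans (max_le ((hw j i hi).trans ?_) ?_)
    · exact (exp_le_exp.mpr (neg_nonpos.mpr (hE i))).trans_eq exp_zero
    · exact mem_boundedAdele.mp (r j).2 i
  have hmem : ∑ j, c j • r j ∈ N := by
    refine mem_boundedAdele.mpr fun i => ?_
    by_cases hi : i ∈ E.support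
    · have hdiff : (∑ j, c j • (w j - (r j : ι → K) i)) ∈ S.ball i (-E i) :=
        sum_mem fun j _ => Submodule.smul_mem _ _ (hw j i hi)
      have hsub := sub_mem (show _ ∈ S.ball i (-E i) from hc i hi) hdiff
      rw [← Finset.sum_sub_distrib] at hsub
      simp only [← smul_sub, sub_sub_cancel] at hsub
      rw [map_sum, Finset.sum_apply]
      exact hsub
    · rw [Finsupp.neg_apply, Finsupp.notMem_support_iff.mp hi, neg_zero]
      exact mem_boundedAdele.mp (∑ j, c j • r j).2 i
  have hzero : ∑ j, c j • b j = 0 := by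
    rw [← (Submodule.Quotient.mk_eq_zero N).mpr hmem, ← Submodule.mkQ_apply, map_sum]
    simp only [map_smul, Submodule.mkQ_apply, hr]
  exact funext (Fintype.linearIndependent_iff.mp b.linearIndependent c hzero)

theorem degree_poleDivisor_le_finrank (x : K) [FiniteDimensional k⟮x⟯ K] :
    S.degree (S.poleDivisor x) ≤ Module.finrank k⟮x⟯ K := by
  obtain ⟨w, hw, hindep⟩ := S.exists_independent_mod_divisor _ (S.poleDivisor_nonneg x)
  have hlin : LinearIndependent k⟮x⟯ w := by
    refine S.linearIndependent_adjoin_of_residues (fun j i hi => hw j i ?_)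
      fun c hc => hindep c fun i hi => ?_
    · exact Finsupp.mem_support_iff.mpr (zero_lt_one.trans_le (S.one_le_poleDivisor hi)).ne'
    · have hi := S.one_lt_val_of_mem_support_poleDivisor hi
      have hle := hc i hi
      rw [S.val_eq_exp_poleDivisor hi, ← le_mul_inv_iff₀ exp_pos, one_mul] at hle
      rwa [exp_neg]
  have hcard := hlin.fintype_card_le_finrank
  rw [Fintype.card_fin] at hcard
  exact Int.toNat_le.mp hcard

/-- The space `L(F)` of the functions whose poles are bounded by the divisor `F`. -/
def riemannRochSpace (F : ι →₀ ℤ) : Submodule k K := (S.boundedAdele F).comap S.diagonal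

/-- The first cohomology `H¹(F)` of a divisor `F`, presented by adeles. -/
abbrev H1 (F : ι →₀ ℤ) : Type _ :=
  S.adele ⧸ (S.boundedAdele F ⊔ S.principal).comap S.adele.subtype

variable {S}

theorem mem_riemannRochSpace {F : ι →₀ ℤ} {s : K} :
    s ∈ S.riemannRochSpace F ↔ ∀ i, S.val i s ≤ exp (F i) := mem_boundedAdele

theorem mul_mem_boundedAdele {F G : ι →₀ ℤ} {r r' : ι → K} (hr : r ∈ S.boundedAdele F)
    (hr' : r' ∈ S.boundedAdele G) : r * r' ∈ S.boundedAdele (F + G) :=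
  mem_boundedAdele.mpr fun i => by
    rw [Pi.mul_apply, map_mul, Finsupp.add_apply, exp_add]
    exact mul_le_mul' (mem_boundedAdele.mp hr i) (mem_boundedAdele.mp hr' i)

theorem mul_mem_riemannRochSpace {F G : ι →₀ ℤ} {s t : K} (hs : s ∈ S.riemannRochSpace F)
    (ht : t ∈ S.riemannRochSpace G) : s * t ∈ S.riemannRochSpace (F + G) :=
  mul_mem_boundedAdele (r := S.diagonal s) (r' := S.diagonal t) hs ht

variable (S)

theorem riemannRochSpace_mono : Monotone S.riemannRochSpace :=
  fun _ _ h => Submodule.comap_mono (S.boundedAdele_mono h)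

theorem algebraMap_mem_riemannRochSpace_zero (c : k) :
    algebraMap k K c ∈ S.riemannRochSpace 0 :=
  mem_riemannRochSpace.mpr (S.val_algebraMap_le_one · c)

theorem length_riemannRochSpace_zero : Module.length k (S.riemannRochSpace 0) = 1 := by
  have hrange : S.riemannRochSpace 0 = LinearMap.range (Algebra.linearMap k K) := by
    refine le_antisymm (fun s hs => ?_) ?_
    · exact S.mem_range_of_forall_val_le_one s (mem_riemannRochSpace.mp hs)
    · rintro _ ⟨c, rfl⟩
      exact S.algebraMap_mem_riemannRochSpace_zero c
  rw [hrange, ← (LinearEquiv.ofInjective _ (algebraMap k K).injective).length_eq,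
    Module.length_eq_finrank, Module.finrank_self, Nat.cast_one]

theorem length_riemannRochSpace_add {F G : ι →₀ ℤ} (h : F ≤ G) :
    Module.length k (S.riemannRochSpace F) +
      relLength (S.riemannRochSpace F) (S.riemannRochSpace G) =
        Module.length k (S.riemannRochSpace G) := by
  rw [← relLength_bot, ← relLength_bot, relLength_add bot_le (S.riemannRochSpace_mono h)]

theorem relLength_riemannRochSpace_add {F G : ι →₀ ℤ} (h : F ≤ G) :
    relLength (S.riemannRochSpace F) (S.riemannRochSpace G) +
      relLength (S.boundedAdele F ⊔ S.principal) (S.boundedAdele G ⊔ S.principal) =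
        (S.degree (G - F)).toNat := by
  rw [riemannRochSpace, riemannRochSpace, relLength_comap,
    relLength_inf_add_relLength_sup (S.boundedAdele_mono h), S.relLength_boundedAdele h]

theorem exists_mem_boundedAdele_nsmul_poleDivisor {x : K} {r : ι → K}
    (hr : ∀ i, S.val i x ≤ 1 → S.val i (r i) ≤ 1) :
    ∃ c : ℕ, r ∈ S.boundedAdele (c • S.poleDivisor x) := by
  obtain ⟨c, hc⟩ := ((S.finite_poles x).image fun i => (log (S.val i (r i))).toNat).bddAbove
  refine ⟨c, mem_boundedAdele.mpr fun i => ?_⟩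
  rw [Finsupp.smul_apply, nsmul_eq_mul]
  rcases le_or_gt (S.val i x) 1 with hi | hi
  · refine (hr i hi).trans ?_
    rw [← exp_zero, exp_le_exp]
    exact mul_nonneg (Nat.cast_nonneg c) (S.poleDivisor_nonneg x i)
  · refine le_exp_of_log_le ?_
    have hlog := Int.toNat_le.mp (hc ⟨i, hi, rfl⟩)
    exact hlog.trans (le_mul_of_one_le_right (Nat.cast_nonneg c) (S.one_le_poleDivisor hi))

theorem exists_aeval_mul_mem_riemannRochSpace (x u : K) :
    ∃ q ∈ k[X]⁰, ∃ c : ℕ, aeval x q * u ∈ S.riemannRochSpace (c • S.poleDivisor x) := by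
  have hfinite : {i | S.val i x ≤ 1 ∧ 1 < S.val i u}.Finite :=
    (S.finite_poles u).subset fun i hi => hi.2
  obtain ⟨q, hq0, hq⟩ := S.exists_forall_val_aeval_mul_lt_one (T := hfinite.toFinset)
    (fun i hi => (hfinite.mem_toFinset.mp hi).1)
    (fun i hi => S.exists_val_aeval_lt_one (hfinite.mem_toFinset.mp hi).1) u
  refine ⟨q, hq0, S.exists_mem_boundedAdele_nsmul_poleDivisor fun i hi => ?_⟩
  change S.val i (aeval x q * u) ≤ 1
  rcases le_or_gt (S.val i u) 1 with hu | hu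
  · rw [map_mul]
    exact mul_le_one' (S.val_aeval_le_one hi q) hu
  · exact (hq i (hfinite.mem_toFinset.mpr ⟨hi, hu⟩)).le

theorem exists_linearIndependent_mem_riemannRochSpace {x : K} (hx : Transcendental k x)
    {σ : Type*} [Finite σ] {u : σ → K} (hu : LinearIndependent k⟮x⟯ u) :
    ∃ w : σ → K, LinearIndependent k⟮x⟯ w ∧
      ∃ c : ℕ, ∀ j, w j ∈ S.riemannRochSpace (c • S.poleDivisor x) := by
  have := Fintype.ofFinite σ
  choose q hq0 c hc using fun j => S.exists_aeval_mul_mem_riemannRochSpace x (u j)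
  obtain ⟨b, hb⟩ := Finite.exists_le c
  refine ⟨fun j => aeval x (q j) * u j, ?_, b, fun j =>
    S.riemannRochSpace_mono (nsmul_le_nsmul_left (S.poleDivisor_nonneg x) (hb j)) (hc j)⟩
  rw [linearIndependent_adjoin_simple_iff] at hu ⊢
  intro p hp j
  have hpq := hu (fun j => p j * q j) (by simpa only [map_mul, mul_assoc] using hp) j
  rw [map_mul] at hpq
  refine (mul_eq_zero.mp hpq).resolve_right fun h0 => nonZeroDivisors.ne_zero (hq0 j) ?_
  exact transcendental_iff.mp hx _ h0

theorem pow_mem_riemannRochSpace (x : K) (e : ℕ) :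
    x ^ e ∈ S.riemannRochSpace (e • S.poleDivisor x) := by
  induction e with
  | zero =>
    rw [pow_zero, zero_nsmul, ← map_one (algebraMap k K)]
    exact S.algebraMap_mem_riemannRochSpace_zero 1
  | succ e ih =>
    rw [pow_succ, succ_nsmul]
    exact mul_mem_riemannRochSpace ih (mem_riemannRochSpace.mpr (S.val_le_exp_poleDivisor x))

theorem card_mul_le_length_riemannRochSpace {x : K} (hx : Transcendental k x) {σ : Type*}
    [Fintype σ] {w : σ → K} (hw : LinearIndependent k⟮x⟯ w) {c : ℕ}
    (hc : ∀ j, w j ∈ S.riemannRochSpace (c • S.poleDivisor x)) (m : ℕ) :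
    (((m + 1) * Fintype.card σ : ℕ) : ℕ∞) ≤
      Module.length k (S.riemannRochSpace ((m + c) • S.poleDivisor x)) := by
  have hmem (p : Fin (m + 1) × σ) :
      x ^ (p.1 : ℕ) * w p.2 ∈ S.riemannRochSpace ((m + c) • S.poleDivisor x) := by
    rw [add_nsmul]
    refine mul_mem_riemannRochSpace (S.riemannRochSpace_mono ?_ (S.pow_mem_riemannRochSpace x p.1))
      (hc p.2)
    exact nsmul_le_nsmul_left (S.poleDivisor_nonneg x) (Nat.lt_succ_iff.mp p.1.2)
  have hindep := (linearIndependent_pow_mul hx hw).comp (Prod.map (Fin.val (n := m + 1)) id)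
    (Fin.val_injective.prodMap Function.injective_id)
  let v (p : Fin (m + 1) × σ) : S.riemannRochSpace ((m + c) • S.poleDivisor x) := ⟨_, hmem p⟩
  have hv : LinearIndependent k v := .of_comp (Submodule.subtype _) hindep
  simpa only [Fintype.card_prod, Fintype.card_fin] using card_le_length_of_linearIndependent hv

theorem monotone_boundedAdele_nsmul_poleDivisor_sup_principal (x : K) :
    Monotone fun m : ℕ => S.boundedAdele (m • S.poleDivisor x) ⊔ S.principal := fun _ _ h =>
  sup_le_sup_right (S.boundedAdele_mono (nsmul_le_nsmul_left (S.poleDivisor_nonneg x) h)) _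

theorem exists_relLength_nsmul_poleDivisor_le {x : K} (hx : Transcendental k x)
    [FiniteDimensional k⟮x⟯ K] :
    ∃ b : ℕ, ∀ m : ℕ, relLength (S.boundedAdele 0 ⊔ S.principal)
      (S.boundedAdele (m • S.poleDivisor x) ⊔ S.principal) ≤ b := by
  obtain ⟨w, hw, c, hc⟩ := S.exists_linearIndependent_mem_riemannRochSpace hx
    (Module.finBasis k⟮x⟯ K).linearIndependent
  refine ⟨c * Module.finrank k⟮x⟯ K + 1, fun m => ?_⟩
  have hB := S.poleDivisor_nonneg x
  have hmono := S.monotone_boundedAdele_nsmul_poleDivisor_sup_principal x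
  have hle : relLength (S.boundedAdele 0 ⊔ S.principal)
      (S.boundedAdele (m • S.poleDivisor x) ⊔ S.principal) ≤ relLength
        (S.boundedAdele 0 ⊔ S.principal)
          (S.boundedAdele ((m + c) • S.poleDivisor x) ⊔ S.principal) := by
    rw [← relLength_add (by simpa using hmono m.zero_le) (hmono (m.le_add_right c))]
    exact le_self_add
  have hL := S.card_mul_le_length_riemannRochSpace hx hw hc m
  rw [← S.length_riemannRochSpace_add (nsmul_nonneg hB _), S.length_riemannRochSpace_zero,
    Fintype.card_fin] at hL
  have hadd := S.relLength_riemannRochSpace_add (nsmul_nonneg hB (m + c))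
  rw [sub_zero] at hadd
  have hdeg : (S.degree ((m + c) • S.poleDivisor x)).toNat ≤ (m + c) * Module.finrank k⟮x⟯ K := by
    rw [map_nsmul, nsmul_eq_mul, Int.toNat_le, Nat.cast_mul]
    exact mul_le_mul_of_nonneg_left (S.degree_poleDivisor_le_finrank x) (Nat.cast_nonneg _)
  refine hle.trans ?_
  generalize relLength (S.boundedAdele 0 ⊔ S.principal) _ = b at hadd ⊢
  generalize relLength (S.riemannRochSpace 0) _ = a at hadd hL
  lift a to ℕ using ne_top_of_le_ne_top (ENat.natCast_ne_top _) (le_self_add.trans_eq hadd)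
  lift b to ℕ using ne_top_of_le_ne_top (ENat.natCast_ne_top _) (le_add_self.trans_eq hadd)
  norm_cast at hadd hL ⊢
  linarith

theorem adele_le_iSup_boundedAdele_nsmul_poleDivisor {x : K} (hx : Transcendental k x) :
    S.adele ≤ ⨆ m : ℕ, S.boundedAdele (m • S.poleDivisor x) ⊔ S.principal := by
  intro r hr
  obtain ⟨f, hf⟩ := S.strong_approximation hx hr
  obtain ⟨m, hm⟩ := S.exists_mem_boundedAdele_nsmul_poleDivisor (r := r - S.diagonal f) hf
  refine Submodule.mem_iSup_of_mem m ?_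
  rw [← sub_add_cancel r (S.diagonal f)]
  exact Submodule.add_mem_sup hm ⟨f, rfl⟩

theorem finite_H1_zero {x : K} (hx : Transcendental k x) [FiniteDimensional k⟮x⟯ K] :
    Module.Finite k (S.H1 0) := by
  obtain ⟨b, hb⟩ := S.exists_relLength_nsmul_poleDivisor_le hx
  have hiSup : ⨆ m : ℕ, S.boundedAdele (m • S.poleDivisor x) ⊔ S.principal = S.adele :=
    (iSup_le fun m => sup_le (S.boundedAdele_le_adele _) S.principal_le_adele).antisymm
      (S.adele_le_iSup_boundedAdele_nsmul_poleDivisor hx)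
  have hle := relLength_iSup_le
    (S.monotone_boundedAdele_nsmul_poleDivisor_sup_principal x) (b := b)
    (by simpa only [zero_nsmul] using hb)
  rw [hiSup, zero_nsmul] at hle
  exact finite_of_length_ne_top (hle.trans_lt (ENat.natCast_lt_top b)).ne

theorem relLength_sup_principal_add_length_H1 {F G : ι →₀ ℤ} (h : F ≤ G) :
    relLength (S.boundedAdele F ⊔ S.principal) (S.boundedAdele G ⊔ S.principal) +
      Module.length k (S.H1 G) = Module.length k (S.H1 F) :=
  relLength_add (sup_le_sup_right (S.boundedAdele_mono h) _)
    (sup_le (S.boundedAdele_le_adele G) S.principal_le_adele)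

theorem length_riemannRochSpace_add_degree_add_length_H1 {F G : ι →₀ ℤ} (h : F ≤ G) :
    Module.length k (S.riemannRochSpace F) + (S.degree (G - F)).toNat + Module.length k (S.H1 G) =
      Module.length k (S.riemannRochSpace G) + Module.length k (S.H1 F) := by
  rw [← S.relLength_riemannRochSpace_add h, ← S.length_riemannRochSpace_add h,
    ← S.relLength_sup_principal_add_length_H1 h]
  ac_rfl

variable {S}

theorem mul_mem_adele {r r' : ι → K} (hr : r ∈ S.adele) (hr' : r' ∈ S.adele) :
    r * r' ∈ S.adele := by
  refine (Set.Finite.union hr hr').subset fun i hi => ?_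
  contrapose! hi
  simp only [Set.mem_union, Set.mem_ofPred_eq, not_or, not_lt] at hi ⊢
  rw [Pi.mul_apply, map_mul]
  exact mul_le_one' hi.1 hi.2

variable (S)

/-- Multiplication of adeles by functions. -/
def mulAdele : K →ₗ[k] S.adele →ₗ[k] S.adele :=
  LinearMap.mk₂ k (fun s r => ⟨S.diagonal s * r, mul_mem_adele (S.finite_poles s) r.2⟩)
    (fun _ _ _ => by ext; simp [add_mul]) (fun _ _ _ => by ext; simp)
    (fun _ _ _ => by ext; simp [mul_add]) (fun _ _ _ => by ext; simp)

theorem mulAdele_mem {F : ι →₀ ℤ} {s : K} (hs : s ∈ S.riemannRochSpace F) {r : S.adele}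
    (hr : (r : ι → K) ∈ S.boundedAdele 0 ⊔ S.principal) :
    (S.mulAdele s r : ι → K) ∈ S.boundedAdele F ⊔ S.principal := by
  obtain ⟨a, ha, _, ⟨t, rfl⟩, hat⟩ := Submodule.mem_sup.mp hr
  change S.diagonal s * (r : ι → K) ∈ _
  rw [← hat, mul_add]
  refine Submodule.add_mem_sup ?_ ⟨s * t, rfl⟩
  simpa only [add_zero] using mul_mem_boundedAdele hs ha

/-- The multiplication `L(F) × H¹(0) → H¹(F)`. -/
def mulH1 (F : ι →₀ ℤ) : S.riemannRochSpace F →ₗ[k] S.H1 0 →ₗ[k] S.H1 F :=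
  LinearMap.flip <| Submodule.liftQ _
    ((S.mulAdele.compr₂ (Submodule.mkQ _)).domRestrict (S.riemannRochSpace F)).flip
    fun _ hr => LinearMap.ext fun s =>
      (Submodule.Quotient.mk_eq_zero _).mpr (S.mulAdele_mem s.2 hr)

theorem mulH1_surjective {F : ι →₀ ℤ} {s : S.riemannRochSpace F} (hs : s ≠ 0) :
    Function.Surjective (S.mulH1 F s) := fun y => by
  obtain ⟨r, rfl⟩ := Submodule.Quotient.mk_surjective _ y
  refine ⟨Submodule.Quotient.mk (S.mulAdele (s : K)⁻¹ r), ?_⟩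
  have hs0 : (s : K) ≠ 0 := Subtype.coe_ne_coe.mpr hs
  refine congrArg Submodule.Quotient.mk (Subtype.ext (funext fun i => ?_))
  exact mul_inv_cancel_left₀ hs0 _

variable [Module.Finite k (S.H1 0)]

theorem length_riemannRochSpace_le_of_nontrivial_H1 (F : ι →₀ ℤ) [Nontrivial (S.H1 F)] :
    Module.length k (S.riemannRochSpace F) ≤ Module.length k (S.H1 0) :=
  length_le_of_forall_surjective (S.mulH1 F) fun _ => S.mulH1_surjective

instance finite_H1 (F : ι →₀ ℤ) : Module.Finite k (S.H1 F) := by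
  have hsup := S.relLength_sup_principal_add_length_H1 (le_sup_left (a := F) (b := 0))
  have h0 := S.relLength_sup_principal_add_length_H1 (le_sup_right (a := F) (b := 0))
  have hrel := S.relLength_riemannRochSpace_add (le_sup_left (a := F) (b := 0))
  refine finite_of_length_ne_top fun htop => ?_
  rw [← hsup, ENat.add_eq_top] at htop
  refine htop.elim ?_ ?_
  · exact ne_top_of_le_ne_top (ENat.natCast_ne_top _) (le_add_self.trans_eq hrel)
  · exact ne_top_of_le_ne_top Module.length_ne_top (le_add_self.trans_eq h0)

instance finite_riemannRochSpace (F : ι →₀ ℤ) : Module.Finite k (S.riemannRochSpace F) := by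
  have hsup := S.length_riemannRochSpace_add_degree_add_length_H1 (le_sup_right (a := F) (b := 0))
  rw [S.length_riemannRochSpace_zero] at hsup
  have hle := Module.length_le_of_injective
    (Submodule.inclusion (S.riemannRochSpace_mono (le_sup_left (a := F) (b := 0))))
    (Submodule.inclusion_injective _)
  refine finite_of_length_ne_top
    (ne_top_of_le_ne_top ?_ (hle.trans (le_self_add.trans_eq hsup.symm)))
  simp [ENat.add_eq_top, ENat.one_ne_top, Module.length_ne_top]

theorem finrank_riemannRochSpace_sub_finrank_H1 {F G : ι →₀ ℤ} (h : F ≤ G) :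
    (Module.finrank k (S.riemannRochSpace F) : ℤ) - Module.finrank k (S.H1 F) - S.degree F =
      Module.finrank k (S.riemannRochSpace G) - Module.finrank k (S.H1 G) - S.degree G := by
  have hdeg := Int.toNat_of_nonneg (S.degree_nonneg (sub_nonneg.mpr h))
  have hadd := S.length_riemannRochSpace_add_degree_add_length_H1 h
  simp only [Module.length_eq_finrank] at hadd
  rw [map_sub] at hdeg hadd
  norm_cast at hadd
  omega

theorem riemann_roch (F : ι →₀ ℤ) :
    (Module.finrank k (S.riemannRochSpace F) : ℤ) - Module.finrank k (S.H1 F) =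
      S.degree F + 1 - Module.finrank k (S.H1 0) := by
  have hzero := S.length_riemannRochSpace_zero
  rw [Module.length_eq_finrank, Nat.cast_eq_one] at hzero
  have hF := S.finrank_riemannRochSpace_sub_finrank_H1 (le_sup_left (a := F) (b := 0))
  have h0 := S.finrank_riemannRochSpace_sub_finrank_H1 (le_sup_right (a := F) (b := 0))
  rw [map_zero, hzero] at h0
  push_cast at h0
  linarith

theorem finrank_riemannRochSpace {F : ι →₀ ℤ}
    (hF : 2 * (Module.finrank k (S.H1 0) : ℤ) - 2 < S.degree F) :
    (Module.finrank k (S.riemannRochSpace F) : ℤ) = S.degree F + 1 - Module.finrank k (S.H1 0) := by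
  have hRR := S.riemann_roch F
  rcases subsingleton_or_nontrivial (S.H1 F) with hH1 | hH1
  · rwa [Module.finrank_zero_of_subsingleton (M := S.H1 F), Nat.cast_zero, sub_zero] at hRR
  · have hle := S.length_riemannRochSpace_le_of_nontrivial_H1 F
    have hpos := Module.finrank_pos (R := k) (M := S.H1 F)
    rw [Module.length_eq_finrank, Module.length_eq_finrank, Nat.cast_le] at hle
    omega

theorem riemannRochSpace_eq_bot {E : ι →₀ ℤ} (hE : S.degree E < 0) :
    S.riemannRochSpace E = ⊥ := by
  by_contra hne
  obtain ⟨s, hs, hs0⟩ := Submodule.exists_mem_ne_zero_of_ne_bot hne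
  set g := Module.finrank k (S.H1 0)
  let F := -((2 * g + 1) • E)
  have hdeg : S.degree F = -((2 * g + 1) * S.degree E) := by simp [F]
  have hle : Module.finrank k (S.riemannRochSpace F) ≤
      Module.finrank k (S.riemannRochSpace (E + F)) :=
    LinearMap.finrank_le_finrank_of_injective
      (f := (LinearMap.mulLeft k s).restrict fun _ => mul_mem_riemannRochSpace hs)
      fun _ _ h => Subtype.ext (mul_right_injective₀ hs0 (congrArg Subtype.val h))
  have hF := S.finrank_riemannRochSpace (F := F) (by nlinarith)
  have hEF := S.finrank_riemannRochSpace (F := E + F) (by rw [map_add]; nlinarith)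
  rw [map_add] at hEF
  omega

end PlaceSystem

/-! ### The places of a curve -/

section CommutativeAlgebra

open Polynomial IntermediateField CategoryTheory

theorem mem_minimalPrimes_span_singleton {A : Type*} (O : Type*) [CommRing A] [IsNoetherianRing A]
    [CommRing O] [IsDomain O] [IsDiscreteValuationRing O] [Algebra A O] {q : Ideal A} [q.IsPrime]
    [IsLocalization.AtPrime O q] {b : A} (hb : b ∈ nonZeroDivisors A) (hbq : b ∈ q) :
    q ∈ (Ideal.span {b}).minimalPrimes := by
  have hq : q.height = 1 := by
    rw [← WithBot.coe_inj, ← IsLocalization.AtPrime.ringKrullDim_eq_height q O,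
      IsDiscreteValuationRing.ringKrullDim_eq_one O, WithBot.coe_one]
  exact Ideal.mem_minimalPrimes_of_height_le ((Ideal.span_singleton_le_iff_mem q).mpr hbq)
    (hq.trans_le (Ideal.one_le_height_span_singleton_of_mem_nonZeroDivisors hb))

theorem mem_range_algebraMap_iff_mem_ofField {A O K : Type*} [CommRing A] [IsDomain A] [CommRing O]
    [Field K] [Algebra A O] [Algebra O K] [Algebra A K] [IsScalarTower A O K] [IsFractionRing A K]
    (q : Ideal A) [q.IsPrime] [IsLocalization.AtPrime O q] {s : K} :
    s ∈ Set.range (algebraMap O K) ↔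
      s ∈ Localization.subalgebra.ofField K q.primeCompl q.primeCompl_le_nonZeroDivisors := by
  have hmap : Localization.mapToFractionRing K q.primeCompl O q.primeCompl_le_nonZeroDivisors =
      IsScalarTower.toAlgHom A O K :=
    IsLocalization.algHom_ext q.primeCompl (by ext)
  have hiff := Localization.subalgebra.mem_range_mapToFractionRing_iff_ofField K q.primeCompl
    q.primeCompl_le_nonZeroDivisors O s
  rwa [hmap] at hiff

section Etale

variable (k A K : Type*) [Field k] [CommRing A] [Field K] [Algebra k A] [Algebra k K]
  [Algebra A K] [IsScalarTower k A K] [Algebra k[X] A] [IsScalarTower k k[X] A]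

theorem algebraMap_algebraMap_polynomial (f : k[X]) :
    algebraMap A K (algebraMap k[X] A f) = aeval (algebraMap A K (algebraMap k[X] A X)) f := by
  rw [Polynomial.aeval_algebraMap_apply, Polynomial.aeval_algebraMap_apply, aeval_X_left_apply]

variable [IsFractionRing A K]

theorem transcendental_algebraMap_X_of_flat [Module.Flat k[X] A] :
    Transcendental k (algebraMap A K (algebraMap k[X] A X)) := by
  have : Nontrivial A := (IsFractionRing.nontrivial_iff_nontrivial A K).mpr inferInstance
  have hinj := (IsFractionRing.injective A K).comp (FaithfulSMul.algebraMap_injective k[X] A)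
  exact transcendental_iff_injective.mpr fun f g hfg => hinj <|
    (algebraMap_algebraMap_polynomial k A K f).trans
      (hfg.trans (algebraMap_algebraMap_polynomial k A K g).symm)

theorem finiteDimensional_adjoin_algebraMap_X_of_formallyUnramified [Algebra.FiniteType k[X] A]
    [Algebra.FormallyUnramified k[X] A] :
    FiniteDimensional k⟮algebraMap A K (algebraMap k[X] A X)⟯ K := by
  set x := algebraMap A K (algebraMap k[X] A X)
  let := (aeval (R := k) (AdjoinSimple.gen k x)).toAlgebra
  let := Algebra.compHom K (algebraMap k[X] A)
  have : IsScalarTower k[X] A K := .of_algebraMap_eq' rfl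
  have : IsScalarTower k[X] k⟮x⟯ K := .of_algebraMap_eq fun f =>
    (algebraMap_algebraMap_polynomial k A K f).trans
      (aeval_algebraMap_apply K (AdjoinSimple.gen k x) f)
  have : Algebra.EssFiniteType A K := .of_isLocalization _ (nonZeroDivisors A)
  have : Algebra.EssFiniteType k[X] K := .comp k[X] A K
  have : Algebra.EssFiniteType k⟮x⟯ K := .of_comp k[X] k⟮x⟯ K
  have : Algebra.FormallyUnramified A K := .of_isLocalization (nonZeroDivisors A)
  have : Algebra.FormallyUnramified k[X] K := .comp k[X] A K
  have : Algebra.FormallyUnramified k⟮x⟯ K := .of_restrictScalars k[X] k⟮x⟯ K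
  exact Algebra.FormallyUnramified.finite_of_free k⟮x⟯ K

end Etale

/-- The codiagonal `D → L` is injective because `D` is a domain integral over `k`; as it retracts
both coprojections, they coincide. -/
theorem epi_of_isPushout_self_of_isDomain {k : Type u} [Field k] {L D : CommRingCat.{u}}
    [Nontrivial L] [IsDomain D] {f : CommRingCat.of k ⟶ L} {a b : L ⟶ D} (h : IsPushout f f a b)
    (hf : f.hom.IsIntegral) : Epi f := by
  have hab : a = b := by
    algebraize [f.hom, (f ≫ a).hom]
    let aₖ : L →ₐ[k] D := ⟨a.hom, fun _ => rfl⟩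
    let bₖ : L →ₐ[k] D := ⟨b.hom, fun c => (ConcreteCategory.congr_hom h.w c).symm⟩
    ext y
    by_contra hne
    have hint : IsIntegral k (aₖ y - bₖ y) :=
      (IsIntegral.map aₖ (hf y)).sub (IsIntegral.map bₖ (hf y))
    have hunit := (hint.isUnit (sub_ne_zero.mpr hne)).map (h.desc (𝟙 L) (𝟙 L) rfl).hom
    have hzero : (h.desc (𝟙 L) (𝟙 L) rfl).hom (aₖ y - bₖ y) = 0 := by
      rw [map_sub, sub_eq_zero]
      exact (ConcreteCategory.congr_hom (h.inl_desc (𝟙 L) (𝟙 L) rfl) y).trans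
        (ConcreteCategory.congr_hom (h.inr_desc (𝟙 L) (𝟙 L) rfl) y).symm
    exact not_isUnit_zero (hzero ▸ hunit)
  subst hab
  exact ⟨fun u v huv => (h.inl_desc u v huv).symm.trans (h.inr_desc u v huv)⟩

end CommutativeAlgebra

namespace SmoothProjectiveCurve

open AlgebraicGeometry CategoryTheory TopologicalSpace Polynomial IntermediateField WithZero

variable {k : Type u} [Field k] (C : SmoothProjectiveCurve k)

instance compactSpace : CompactSpace C.X :=
  (quasiCompact_iff_compactSpace C.hom).mp inferInstance

instance isSeparated : C.X.IsSeparated := by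
  rw [Scheme.isSeparated_iff, ← Limits.terminal.comp_from C.hom]
  infer_instance

/-- The structure map `k → Γ(X, 𝒪_X)`. -/
abbrev toGlobalSections : CommRingCat.of k ⟶ Γ(C.X, ⊤) :=
  (Scheme.ΓSpecIso (CommRingCat.of k)).inv ≫ C.hom.appTop

theorem finite_toGlobalSections : C.toGlobalSections.hom.Finite :=
  RingHom.Finite.comp (finite_appTop_of_universallyClosed k C.hom) <| .of_surjective _
    (Scheme.ΓSpecIso (CommRingCat.of k)).symm.commRingCatIsoToRingEquiv.surjective

/-- Flat base change of global sections along `k → Γ(X, 𝒪_X)`. -/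
theorem isPushout_toGlobalSections : IsPushout C.toGlobalSections C.toGlobalSections
    (Limits.pullback.fst C.hom (Spec.map C.toGlobalSections)).appTop
    ((Scheme.ΓSpecIso Γ(C.X, ⊤)).inv ≫
      (Limits.pullback.snd C.hom (Spec.map C.toGlobalSections)).appTop) := by
  let f : Spec Γ(C.X, ⊤) ⟶ Spec (CommRingCat.of k) := Spec.map C.toGlobalSections
  have hiso := isIso_pushoutSection_of_isQuasiSeparated_of_flat_right
    (IsPullback.of_hasPullback C.hom f) (US := ⊤) (UT := ⊤) (UX := ⊤) (UY := ⊤) le_top le_top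
    (by simp) (isAffineOpen_top _) (isAffineOpen_top _) isCompact_univ isQuasiSeparated_univ
  have hpush : IsPushout C.hom.appTop f.appTop (Limits.pullback.fst C.hom f).appTop
      (Limits.pullback.snd C.hom f).appTop := by
    simp only [Scheme.Hom.appTop, Scheme.Hom.app_eq_appLE]
    exact (isIso_pushoutSection_iff _ _ _ _).mp hiso
  refine hpush.of_iso (Scheme.ΓSpecIso _) (Iso.refl _) (Scheme.ΓSpecIso _) (Iso.refl _) ?_ ?_
    ((Category.comp_id _).trans (Category.id_comp _).symm) ?_
  · simp
  · exact Scheme.ΓSpecIso_naturality _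
  · exact (Category.comp_id _).trans (Iso.hom_inv_id_assoc _ _).symm

theorem epi_toGlobalSections : Epi C.toGlobalSections := by
  let := (isField_of_universallyClosed k C.hom).toField
  let f : Spec Γ(C.X, ⊤) ⟶ Spec (CommRingCat.of k) := Spec.map C.toGlobalSections
  have : IsIntegral (Limits.pullback C.hom f) :=
    GeometricallyIntegral.geometrically_isIntegral (f := C.hom) (K := Γ(C.X, ⊤)) f _ _
      (IsPullback.of_hasPullback C.hom f)
  exact epi_of_isPushout_self_of_isDomain C.isPushout_toGlobalSections
    C.finite_toGlobalSections.to_isIntegral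

theorem surjective_toGlobalSections : Function.Surjective C.toGlobalSections.hom :=
  have := C.epi_toGlobalSections
  RingHom.surjective_of_epi_of_finite C.toGlobalSections C.finite_toGlobalSections

instance algebraSections (V : C.X.Opens) : Algebra k Γ(C.X, V) :=
  (C.toGlobalSections ≫ C.X.presheaf.map (homOfLE le_top).op).hom.toAlgebra

theorem algebraMap_localRing (V : C.X.Opens) (x : C.X) (hx : x ∈ V) (c : k) :
    algebraMap k (C.LocalRing x) c = C.X.presheaf.germ V x hx (algebraMap k Γ(C.X, V) c) :=
  (ConcreteCategory.congr_hom (C.X.presheaf.germ_res (homOfLE (le_top (a := V))) x hx)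
    (C.toGlobalSections.hom c)).symm

theorem algebraMap_sections (V : C.X.Opens) [Nonempty V] (c : k) :
    algebraMap Γ(C.X, V) C.FunctionField (algebraMap k Γ(C.X, V) c) =
      algebraMap k C.FunctionField c :=
  (C.algebraMap_localRing V (genericPoint C.X)
    (((genericPoint_spec C.X).mem_open_set_iff V.isOpen).mpr (by simpa using ‹Nonempty V›)) c).symm

theorem finiteType_sections {V : C.X.Opens} (hV : IsAffineOpen V) :
    Algebra.FiniteType k Γ(C.X, V) :=
  (C.hom.finiteType_appLE (isAffineOpen_top _) hV le_top).comp <|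
    RingHom.FiniteType.of_surjective (Scheme.ΓSpecIso (CommRingCat.of k)).inv.hom
      (Scheme.ΓSpecIso (CommRingCat.of k)).symm.commRingCatIsoToRingEquiv.surjective

theorem exists_chart (x : C.X) : ∃ V : C.X.Opens, IsAffineOpen V ∧ x ∈ V ∧
    Algebra.IsStandardSmoothOfRelativeDimension 1 k Γ(C.X, V) := by
  obtain ⟨U, hU, V, hV, hxV, hVU, hsmooth⟩ :=
    SmoothOfRelativeDimension.exists_isStandardSmoothOfRelativeDimension (n := 1) (f := C.hom) x
  obtain rfl : U = ⊤ := Opens.ext <| Set.eq_univ_of_forall fun y =>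
    Subsingleton.elim (C.hom x) y ▸ hVU hxV
  exact ⟨V, hV, hxV, RingHom.isStandardSmoothOfRelativeDimension_respectsIso.2
    (C.hom.appLE ⊤ V hVU).hom
    (Scheme.ΓSpecIso (CommRingCat.of k)).symm.commRingCatIsoToRingEquiv hsmooth⟩

theorem exists_transcendental_finiteDimensional : ∃ x : C.FunctionField,
    Transcendental k x ∧ FiniteDimensional k⟮x⟯ C.FunctionField := by
  obtain ⟨V, hV, hηV, _⟩ := C.exists_chart (genericPoint C.X)
  have : Nonempty V := ⟨⟨_, hηV⟩⟩
  have := functionField_isFractionRing_of_isAffineOpen C.X V hV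
  have : IsScalarTower k Γ(C.X, V) C.FunctionField :=
    .of_algebraMap_eq fun c => (C.algebraMap_sections V c).symm
  obtain ⟨g, hg⟩ :=
    Algebra.IsStandardSmoothOfRelativeDimension.exists_etale_mvPolynomial 1 k Γ(C.X, V)
  let h : k[X] →ₐ[k] Γ(C.X, V) := g.comp (MvPolynomial.uniqueAlgEquiv k (Fin 1)).symm.toAlgHom
  let := h.toRingHom.toAlgebra
  have : IsScalarTower k k[X] Γ(C.X, V) := .of_algebraMap_eq' h.comp_algebraMap.symm
  have : Algebra.Etale k[X] Γ(C.X, V) :=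
    RingHom.Etale.respectsIso.2 (g : MvPolynomial (Fin 1) k →+* Γ(C.X, V))
      ((MvPolynomial.uniqueAlgEquiv k (Fin 1)).symm : k[X] ≃+* MvPolynomial (Fin 1) k) hg
  exact ⟨_, transcendental_algebraMap_X_of_flat k Γ(C.X, V) C.FunctionField,
    finiteDimensional_adjoin_algebraMap_X_of_formallyUnramified k Γ(C.X, V) C.FunctionField⟩

variable {C}

namespace ClosedPoint

theorem valuation_le_one_iff (x : C.ClosedPoint) {s : C.FunctionField} :
    x.valuation s ≤ 1 ↔ s ∈ Set.range (algebraMap x.O C.FunctionField) :=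
  ⟨IsDiscreteValuationRing.exists_lift_of_le_one, fun ⟨a, ha⟩ => ha ▸ x.valuation_le_one a⟩

theorem valuation_algebraMap_le_one (x : C.ClosedPoint) (c : k) :
    x.valuation (algebraMap k C.FunctionField c) ≤ 1 := by
  rw [IsScalarTower.algebraMap_apply k x.O C.FunctionField]
  exact x.valuation_le_one _

theorem residue_eq_zero_iff (x : C.ClosedPoint) (a : x.O) :
    algebraMap x.O x.κ a = 0 ↔ x.valuation (algebraMap x.O C.FunctionField a) ≤ exp (-1) := by
  rw [IsLocalRing.ResidueField.algebraMap_eq, IsLocalRing.residue_eq_zero_iff,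
    ← lt_mul_exp_iff_le exp_ne_zero, ← exp_add, neg_add_cancel, exp_zero]
  exact (IsDedekindDomain.HeightOneSpectrum.valuation_lt_one_iff_mem
    (IsDiscreteValuationRing.maximalIdeal x.O) a).symm

theorem finite_residueField (x : C.ClosedPoint) : Module.Finite k x.κ := by
  obtain ⟨V, hV, hx, -⟩ := C.exists_chart x.1
  have := C.finiteType_sections hV
  have := hV.primeIdealOf_isMaximal_of_isClosed ⟨x.1, hx⟩ x.2
  have := hV.isLocalization_stalk ⟨x.1, hx⟩
  let := TopCat.Presheaf.algebra_section_stalk C.X.presheaf (⟨x.1, hx⟩ : V)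
  let res : Γ(C.X, V) →ₐ[k] x.κ :=
    { (IsLocalRing.residue x.O).comp (algebraMap Γ(C.X, V) x.O) with
      commutes' := fun c =>
        congrArg (IsLocalRing.residue x.O) (C.algebraMap_localRing V x.1 hx c).symm }
  have hres : Function.Surjective res :=
    (IsLocalization.AtPrime.equivQuotMaximalIdeal
      (hV.primeIdealOf ⟨x.1, hx⟩).asIdeal x.O).surjective.comp Ideal.Quotient.mk_surjective
  have : Algebra.FiniteType k x.κ := .of_surjective res hres
  exact finite_of_finite_type_of_isJacobsonRing k x.κ

theorem relLength_residue (x : C.ClosedPoint) :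
    relLength (valuationBall x.valuation x.valuation_algebraMap_le_one (-1))
      (valuationBall x.valuation x.valuation_algebraMap_le_one 0) = Module.finrank k x.κ := by
  have := x.finite_residueField
  let incl : x.O →ₗ[k] C.FunctionField :=
    (IsScalarTower.toAlgHom k x.O C.FunctionField).toLinearMap
  let res : x.O →ₗ[k] x.κ := (IsScalarTower.toAlgHom k x.O x.κ).toLinearMap
  have hcomap := relLength_comap incl
    (valuationBall x.valuation x.valuation_algebraMap_le_one (-1))
    (valuationBall x.valuation x.valuation_algebraMap_le_one 0)
  have hball {m : ℤ} (hm : m ≤ 0) :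
      valuationBall x.valuation x.valuation_algebraMap_le_one m ≤ LinearMap.range incl :=
    fun s hs => x.valuation_le_one_iff.mp (le_trans hs (exp_le_exp.mpr hm))
  rw [inf_eq_left.mpr (hball (by decide)), inf_eq_left.mpr (hball le_rfl)] at hcomap
  have hzero : (valuationBall x.valuation x.valuation_algebraMap_le_one 0).comap incl = ⊤ :=
    eq_top_iff.mpr fun a _ => x.valuation_le_one a
  rw [← hcomap, hzero, relLength_eq_length_of_surjective (res.domRestrict ⊤),
    Module.length_eq_finrank]
  · exact fun y => (IsLocalRing.residue_surjective y).imp' (fun a => ⟨a, trivial⟩) fun _ ha => ha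
  · ext a
    exact x.residue_eq_zero_iff a

theorem valuation_le_one_iff_mem_ofField (x : C.ClosedPoint) {V : C.X.Opens} [Nonempty V]
    (hV : IsAffineOpen V) [IsFractionRing Γ(C.X, V) C.FunctionField] (hx : x.1 ∈ V)
    {s : C.FunctionField} :
    x.valuation s ≤ 1 ↔ s ∈ Localization.subalgebra.ofField C.FunctionField
      (hV.primeIdealOf ⟨x.1, hx⟩).asIdeal.primeCompl
      (hV.primeIdealOf ⟨x.1, hx⟩).asIdeal.primeCompl_le_nonZeroDivisors := by
  have := hV.isLocalization_stalk ⟨x.1, hx⟩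
  let := TopCat.Presheaf.algebra_section_stalk C.X.presheaf (⟨x.1, hx⟩ : V)
  have := functionField_isScalarTower C.X V ⟨x.1, hx⟩
  exact x.valuation_le_one_iff.trans (mem_range_algebraMap_iff_mem_ofField _)

theorem mem_minimalPrimes_of_one_lt_valuation (x : C.ClosedPoint) {V : C.X.Opens} [Nonempty V]
    (hV : IsAffineOpen V) (hx : x.1 ∈ V) {a b : Γ(C.X, V)} (hb : b ∈ nonZeroDivisors Γ(C.X, V))
    (hpole : 1 < x.valuation (algebraMap _ C.FunctionField a / algebraMap _ C.FunctionField b)) :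
    (hV.primeIdealOf ⟨x.1, hx⟩).asIdeal ∈ (Ideal.span {b}).minimalPrimes := by
  have := C.finiteType_sections hV
  have : IsNoetherianRing Γ(C.X, V) := Algebra.FiniteType.isNoetherianRing k _
  have := functionField_isFractionRing_of_isAffineOpen C.X V hV
  have := hV.isLocalization_stalk ⟨x.1, hx⟩
  let := TopCat.Presheaf.algebra_section_stalk C.X.presheaf (⟨x.1, hx⟩ : V)
  refine mem_minimalPrimes_span_singleton x.O hb ?_
  by_contra hbq
  exact hpole.not_ge
    ((x.valuation_le_one_iff_mem_ofField hV hx).mpr ⟨a, b, hbq, div_eq_mul_inv _ _⟩)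

end ClosedPoint

theorem finite_poles_of_isAffineOpen {V : C.X.Opens} (hV : IsAffineOpen V) (s : C.FunctionField) :
    {x : C.ClosedPoint | x.1 ∈ V ∧ 1 < x.valuation s}.Finite := by
  rcases isEmpty_or_nonempty V with hVe | hVn
  · exact Set.finite_empty.subset fun x hx => hVe.elim ⟨x.1, hx.1⟩
  have := C.finiteType_sections hV
  have : IsNoetherianRing Γ(C.X, V) := Algebra.FiniteType.isNoetherianRing k _
  have := functionField_isFractionRing_of_isAffineOpen C.X V hV
  obtain ⟨a, b, hb, rfl⟩ := IsFractionRing.div_surjective (A := Γ(C.X, V)) s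
  have hprimes := (Ideal.finite_minimalPrimes_of_isNoetherianRing _ (Ideal.span {b})).preimage
    (f := PrimeSpectrum.asIdeal) (fun _ _ _ _ => PrimeSpectrum.ext)
  refine ((hprimes.image hV.fromSpec).preimage Subtype.val_injective.injOn).subset ?_
  rintro (x : C.ClosedPoint) ⟨hx, hpole⟩
  exact ⟨hV.primeIdealOf ⟨x.1, hx⟩, x.mem_minimalPrimes_of_one_lt_valuation hV hx hb hpole,
    hV.fromSpec_primeIdealOf _⟩

theorem finite_poles (s : C.FunctionField) : {x : C.ClosedPoint | 1 < x.valuation s}.Finite := by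
  obtain ⟨I, hI, hcover⟩ := isCompact_iff_finite_and_eq_biUnion_affineOpens
    (U := (⊤ : C.X.Opens)).mp isCompact_univ
  refine (hI.biUnion fun V _ => finite_poles_of_isAffineOpen V.2 s).subset fun x hx => ?_
  obtain ⟨V, hVI, hxV⟩ : ∃ V ∈ I, x.1 ∈ V.1 := by
    simpa only [Opens.mem_iSup, exists_prop] using hcover.le (Opens.mem_top x.1)
  exact Set.mem_biUnion hVI ⟨hxV, hx⟩

theorem specializes_of_ringHom {x y : C.X} (φ : C.LocalRing x →+* C.LocalRing y)
    (hφ : (algebraMap (C.LocalRing y) C.FunctionField).comp φ =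
      algebraMap (C.LocalRing x) C.FunctionField) : y ⤳ x := by
  have hgx := (genericPoint_spec C.X).specializes (Set.mem_univ x)
  have hgy := (genericPoint_spec C.X).specializes (Set.mem_univ y)
  let ψ : C.X.presheaf.stalk x ⟶ C.X.presheaf.stalk y := CommRingCat.ofHom φ
  have hψ : ψ ≫ C.X.presheaf.stalkSpecializes hgy = C.X.presheaf.stalkSpecializes hgx :=
    CommRingCat.hom_ext hφ
  let η := Spec.map (C.X.presheaf.stalkSpecializes hgy)
  have : IsDominant η := by
    refine ⟨(PrimeSpectrum.denseRange_comap_iff_ker_le_nilRadical _).mpr ?_⟩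
    refine le_of_eq_of_le ((RingHom.injective_iff_ker_eq_bot _).mp ?_) bot_le
    exact IsFractionRing.injective (C.LocalRing y) C.FunctionField
  have hη : η ≫ Spec.map ψ ≫ C.X.fromSpecStalk x = η ≫ C.X.fromSpecStalk y := by
    rw [← Category.assoc, ← Spec.map_comp, hψ, Scheme.SpecMap_stalkSpecializes_fromSpecStalk,
      Scheme.SpecMap_stalkSpecializes_fromSpecStalk]
  have hy : y ∈ Set.range (C.X.fromSpecStalk x) := by
    let z : Spec (C.X.presheaf.stalk y) := IsLocalRing.closedPoint (C.X.presheaf.stalk y)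
    refine ⟨Spec.map ψ z, ?_⟩
    rw [← Scheme.Hom.comp_apply, ext_of_isDominant η hη]
    exact Scheme.fromSpecStalk_closedPoint
  rwa [Scheme.range_fromSpecStalk] at hy

theorem ClosedPoint.incomparable : Pairwise fun x y : C.ClosedPoint =>
    ∃ s, x.valuation s ≤ 1 ∧ 1 < y.valuation s := by
  intro x y hxy
  by_contra! h
  choose φ hφ using fun a : x.O => y.valuation_le_one_iff.mp (h _ (x.valuation_le_one a))
  have hinj := IsFractionRing.injective y.O C.FunctionField
  let φ' : x.O →+* y.O :=
    { toFun := φ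
      map_one' := hinj (by simp only [hφ, map_one])
      map_mul' := fun a b => hinj (by simp only [hφ, map_mul])
      map_zero' := hinj (by simp only [hφ, map_zero])
      map_add' := fun a b => hinj (by simp only [hφ, map_add]) }
  have hspec : y.1 ⤳ x.1 := specializes_of_ringHom φ' (RingHom.ext hφ)
  exact hxy (Subtype.ext (hspec.mem_closed y.2 rfl))

theorem exists_closedPoint_of_isMaximal {V : C.X.Opens} (hV : IsAffineOpen V)
    (q : MaximalSpectrum Γ(C.X, V)) :
    ∃ (x : C.ClosedPoint) (hx : x.1 ∈ V), (hV.primeIdealOf ⟨x.1, hx⟩).asIdeal = q.asIdeal := by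
  let z := q.toPrimeSpectrum
  have : JacobsonSpace C.X := LocallyOfFiniteType.jacobsonSpace C.hom
  have hopen := hV.fromSpec.isOpenEmbedding
  have hclosed : IsClosed {hV.fromSpec z} :=
    (Set.ext_iff.mp hopen.preimage_closedPoints z).mpr
      ((PrimeSpectrum.isClosed_singleton_iff_isMaximal z).mpr q.isMaximal)
  have hmem : hV.fromSpec z ∈ V := hV.range_fromSpec.le ⟨z, rfl⟩
  exact ⟨⟨hV.fromSpec z, hclosed⟩, hmem,
    congrArg PrimeSpectrum.asIdeal (hopen.injective (hV.fromSpec_primeIdealOf ⟨_, hmem⟩))⟩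

theorem mem_range_algebraMap_sections_of_isAffineOpen {V : C.X.Opens} [Nonempty V]
    (hV : IsAffineOpen V) {s : C.FunctionField} (hs : ∀ x : C.ClosedPoint, x.valuation s ≤ 1) :
    s ∈ Set.range (algebraMap Γ(C.X, V) C.FunctionField) := by
  have := functionField_isFractionRing_of_isAffineOpen C.X V hV
  rw [← Algebra.mem_bot, ← MaximalSpectrum.iInf_localization_eq_bot Γ(C.X, V) C.FunctionField,
    Algebra.mem_iInf]
  intro q
  obtain ⟨x, hx, hq⟩ := exists_closedPoint_of_isMaximal hV q
  simpa only [hq] using (x.valuation_le_one_iff_mem_ofField hV hx).mp (hs x)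

theorem mem_range_algebraMap_of_valuation_le_one {s : C.FunctionField}
    (hs : ∀ x : C.ClosedPoint, x.valuation s ≤ 1) :
    s ∈ Set.range (algebraMap k C.FunctionField) := by
  choose W hW hxW _ using C.exists_chart
  have (x : C.X) : Nonempty (W x) := ⟨⟨x, hxW x⟩⟩
  choose f hf using fun x => mem_range_algebraMap_sections_of_isAffineOpen (hW x) hs
  have hη (x : C.X) : genericPoint C.X ∈ W x :=
    ((genericPoint_spec C.X).mem_open_set_iff (W x).isOpen).mpr ⟨x, trivial, hxW x⟩
  have hcompat : TopCat.Presheaf.IsCompatible C.X.sheaf.1 W f := fun x y => by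
    have : Nonempty (W x ⊓ W y : C.X.Opens) := ⟨⟨genericPoint C.X, hη x, hη y⟩⟩
    apply C.X.germToFunctionField_injective (W x ⊓ W y)
    exact (C.X.presheaf.germ_res_apply _ _ _ (f x)).trans <|
      (hf x).trans <| (hf y).symm.trans (C.X.presheaf.germ_res_apply _ _ _ (f y)).symm
  obtain ⟨t, ht, -⟩ := C.X.sheaf.existsUnique_gluing' W ⊤ (fun x => homOfLE le_top)
    (fun x _ => Opens.mem_iSup.mpr ⟨x, hxW x⟩) f hcompat
  obtain ⟨c, rfl⟩ := C.surjective_toGlobalSections t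
  refine ⟨c, ?_⟩
  rw [← C.algebraMap_sections (W (genericPoint C.X)), ← hf (genericPoint C.X)]
  exact congrArg _ (ht (genericPoint C.X))

variable (C)

/-- The places of a smooth projective curve: its closed points. -/
def placeSystem : PlaceSystem k C.FunctionField C.ClosedPoint where
  val := ClosedPoint.valuation
  residueDegree x := Module.finrank k x.κ
  val_algebraMap_le_one := ClosedPoint.valuation_algebraMap_le_one
  exists_val_eq_exp_neg_one x :=
    IsDedekindDomain.HeightOneSpectrum.valuation_exists_uniformizer C.FunctionField
      (IsDiscreteValuationRing.maximalIdeal x.O)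
  finite_poles := finite_poles
  relLength_residue := ClosedPoint.relLength_residue
  incomparable := ClosedPoint.incomparable
  mem_range_of_forall_val_le_one _ := mem_range_algebraMap_of_valuation_le_one

instance finite_H1_placeSystem : Module.Finite k (C.placeSystem.H1 0) := by
  obtain ⟨x, hx, hfin⟩ := C.exists_transcendental_finiteDimensional
  exact C.placeSystem.finite_H1_zero hx

theorem repartition_eq_adele : C.repartition = C.placeSystem.adele := by
  have hregular (r : C.ClosedPoint → C.FunctionField) (x : C.ClosedPoint) :
      r x ∉ x.regular ↔ 1 < x.valuation (r x) :=
    (not_congr x.valuation_le_one_iff.symm).trans not_le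
  ext r
  exact Iff.of_eq (congrArg Set.Finite (Set.ext (hregular r)))

theorem integralRepartition_eq_boundedAdele :
    C.integralRepartition = C.placeSystem.boundedAdele 0 :=
  congrArg (Submodule.pi Set.univ) <|
    funext fun x => Submodule.ext fun _ => x.valuation_le_one_iff.symm

theorem genus_eq_finrank_H1 : C.genus = Module.finrank k (C.placeSystem.H1 0) :=
  congrArg₂ (fun A B : Submodule k (C.ClosedPoint → C.FunctionField) =>
    Module.finrank k (A ⧸ (B ⊔ LinearMap.range C.diagonal).comap A.subtype))
    C.repartition_eq_adele C.integralRepartition_eq_boundedAdele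

theorem L_eq_riemannRochSpace (G : C.Divisor) : C.L G = C.placeSystem.riemannRochSpace G :=
  Submodule.ext fun s =>
    (C.mem_L_iff_aux G s).trans (PlaceSystem.mem_riemannRochSpace (S := C.placeSystem)).symm

variable {C}

theorem finrank_L {G : C.Divisor} (hG : 2 * (C.genus : ℤ) - 2 < G.degree) :
    (Module.finrank k (C.L G) : ℤ) = G.degree + 1 - C.genus := by
  rw [genus_eq_finrank_H1] at hG ⊢
  rw [L_eq_riemannRochSpace]
  exact C.placeSystem.finrank_riemannRochSpace hG

theorem L_eq_bot {G : C.Divisor} (hG : G.degree < 0) : C.L G = ⊥ := by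
  rw [L_eq_riemannRochSpace]
  exact C.placeSystem.riemannRochSpace_eq_bot hG

theorem RationalPoint.valuation_le_of_eval_eq_zero (x : C.RationalPoint) {s : x.1.regular}
    (hs : x.eval s = 0) : x.1.valuation s ≤ exp (-1) := by
  let e := AlgEquiv.ofInjective (IsScalarTower.toAlgHom k x.1.O C.FunctionField)
    (IsFractionRing.injective x.1.O C.FunctionField)
  obtain ⟨a, rfl⟩ := e.surjective s
  refine (x.1.residue_eq_zero_iff a).mp ((map_eq_zero_iff _ x.residueEquiv.symm.injective).mp ?_)
  rw [← hs]
  exact congrArg (fun b => x.residueEquiv.symm (algebraMap x.1.O x.1.κ b))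
    (e.symm_apply_apply a).symm

theorem RationalPoint.finrank_residueField (x : C.RationalPoint) :
    Module.finrank k x.1.κ = 1 := by
  rw [← x.residueEquiv.toLinearEquiv.finrank_eq, Module.finrank_self]

theorem degree_sub_pointDivisor {n : ℕ} (G : C.Divisor) (p : Fin n → C.RationalPoint) :
    (G - C.pointDivisor p).degree = G.degree - n := by
  have hpoint (i : Fin n) : C.placeSystem.degree (Finsupp.single (p i).1 1) = 1 := by
    have hdegree : C.placeSystem.residueDegree (p i).1 = 1 := (p i).finrank_residueField
    simp [PlaceSystem.degree_apply, hdegree]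
  have hD : C.placeSystem.degree (C.pointDivisor p) = n := by
    simp [pointDivisor, hpoint]
  exact (map_sub C.placeSystem.degree _ _).trans (congrArg (G.degree - ·) hD)

theorem pointDivisor_apply_self {n : ℕ} {p : Fin n → C.RationalPoint}
    (hp : Function.Injective p) (i : Fin n) : C.pointDivisor p (p i).1 = 1 := by
  classical
  rw [pointDivisor, Finsupp.finsetSum_apply, Finset.sum_eq_single_of_mem i (Finset.mem_univ i)]
  · exact Finsupp.single_eq_same
  · exact fun j _ hj => Finsupp.single_eq_of_ne fun h => hj (hp (Subtype.ext h.symm))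

theorem pointDivisor_apply_of_ne {n : ℕ} {p : Fin n → C.RationalPoint} {x : C.ClosedPoint}
    (hx : ∀ i, x ≠ (p i).1) : C.pointDivisor p x = 0 := by
  rw [pointDivisor, Finsupp.finsetSum_apply]
  exact Finset.sum_eq_zero fun i _ => Finsupp.single_eq_of_ne (hx i)

theorem mem_L_sub_pointDivisor_of_evaluation_eq_zero {n : ℕ} {p : Fin n → C.RationalPoint}
    (hp : Function.Injective p) {G : C.Divisor}
    (hG : Disjoint G.support (C.pointDivisor p).support) {s : C.L G}
    (hs : C.evaluation p G hG s = 0) : (s : C.FunctionField) ∈ C.L (G - C.pointDivisor p) := by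
  refine (C.mem_L_iff_aux _ _).mpr fun x => ?_
  rw [Finsupp.sub_apply]
  by_cases hx : ∃ i, x = (p i).1
  · obtain ⟨i, rfl⟩ := hx
    have hGi : G (p i).1 = 0 := Finsupp.notMem_support_iff.mp fun h =>
      Finset.disjoint_left.mp hG h (C.mem_support_pointDivisor p i)
    rw [hGi, pointDivisor_apply_self hp]
    exact (p i).valuation_le_of_eval_eq_zero
      (s := Submodule.inclusion (C.L_le_regular p G hG i) s) (congrFun hs i)
  · rw [pointDivisor_apply_of_ne (not_exists.mp hx), sub_zero]
    exact (C.mem_L_iff_aux G s).mp s.2 x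

theorem injective_evaluation {n : ℕ} {p : Fin n → C.RationalPoint} (hp : Function.Injective p)
    {G : C.Divisor} (hG : Disjoint G.support (C.pointDivisor p).support)
    (hdegree : G.degree < (n : ℤ)) : Function.Injective (C.evaluation p G hG) := by
  rw [injective_iff_map_eq_zero]
  intro s hs
  have hmem := mem_L_sub_pointDivisor_of_evaluation_eq_zero hp hG hs
  rw [L_eq_bot ((degree_sub_pointDivisor G p).trans_lt (sub_neg.mpr hdegree))] at hmem
  exact Subtype.ext hmem

end SmoothProjectiveCurve

end ConvolutionalGoppa

end

theorem proposition2p3_general {k : Type u} [Field k]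
    (C : ConvolutionalGoppa.SmoothProjectiveCurve k) {n : ℕ}
    (p : Fin n → C.RationalPoint) (hp : Function.Injective p) (G : C.Divisor)
    (hG : Disjoint G.support (C.pointDivisor p).support)
    (hlow : 2 * (C.genus : ℤ) - 2 < G.degree) (hupp : G.degree < (n : ℤ)) :
    Function.Injective (C.evaluation p G hG) ∧
      (Module.finrank k (C.goppaCode p G hG) : ℤ) = G.degree + 1 - (C.genus : ℤ) := by
  have hinj := C.injective_evaluation hp hG hupp
  refine ⟨hinj, ?_⟩
  rw [ConvolutionalGoppa.SmoothProjectiveCurve.goppaCode, LinearMap.finrank_range_of_inj hinj]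
  exact C.finrank_L hlow

theorem proposition2p3 {F : Type u} [Field F] [Finite F]
    (C : ConvolutionalGoppa.SmoothProjectiveCurve (RatFunc F)) {n : ℕ}
    (p : Fin n → C.RationalPoint) (hp : Function.Injective p) (G : C.Divisor)
    (hG : Disjoint G.support (C.pointDivisor p).support)
    (hlow : 2 * (C.genus : ℤ) - 2 < G.degree) (hupp : G.degree < (n : ℤ)) :
    Function.Injective (C.evaluation p G hG) ∧
      (Module.finrank (RatFunc F) (C.goppaCode p G hG) : ℤ) = G.degree + 1 - (C.genus : ℤ) :=
  proposition2p3_general C p hp G hG hlow hupp
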